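/- Let $\mathcal M=(M,\mathcal O_{\mathcal M})$ be a compact complex supermanifold of dimension $(m|n)$: $M$ is a compact Hausdorff complex manifold of dimension $m$, and $\mathcal O_{\mathcal M}$ is a sheaf of complex ($\mathbb Z/2$-graded) superalgebras on $M$ that is locally, on small enough open sets $W\subseteq M$, isomorphic to $\mathcal O_W\otimes\bigwedge\mathbb C^n$, where $\mathcal O_W$ is the sheaf of holomorphic functions on $W$. Let $\mathrm{Aut}_{\bar 0}(\mathcal M)$ be the set of automorphisms $\varphi=(\tilde\varphi,\varphi^*)$ of $\mathcal M$, i.e. of invertible morphisms $\mathcal M\to\mathcal M$ consisting of a continuous map $\tilde\varphi:M\to M$ and a parity-preserving morphism $\varphi^*:\mathcal O_{\mathcal M}\to\tilde\varphi_*\mathcal O_{\mathcal M}$ of sheaves of $\mathbb C$-algebras. An isomorphism $\mathcal O_{\mathcal M}|_W\cong\mathcal O_W\otimes\bigwedge\mathbb C^n$ of sheaves of superalgebras on an open set $W\subseteq M$ gives odd coordinates $\theta_1,\dots,\theta_n$ on $W$ (corresponding to the standard basis of $\mathbb C^n$), and every section $g$ of $\mathcal O_{\mathcal M}$ over an open set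 $V\subseteq W$ has a unique expansion $g=\sum_{\nu\in(\mathbb Z/2)^n}g_\nu\theta^\nu$ with $g_\nu$ holomorphic on $V$. Given such an isomorphism, a compact set $K\subseteq W$, an open set $U\subseteq M$, a section $f\in\mathcal O_{\mathcal M}(U)$ and open sets $U_\nu\subseteq\mathbb C$ for $\nu\in(\mathbb Z/2)^n$, let $$\Delta(K,U,f,\theta_j,U_\nu)=\{\varphi\in\mathrm{Aut}_{\bar 0}(\mathcal M)\mid \tilde\varphi(K)\subseteq U,\ \varphi_{f,\nu}(K)\subseteq U_\nu\text{ for all }\nu\},$$ where $\varphi^*(f)=\sum_\nu\varphi_{f,\nu}\theta^\nu$ is the expansion on the neighbourhood $W\cap\tilde\varphi^{-1}(U)$ of $K$. Endow $\mathrm{Aut}_{\bar 0}(\mathcal M)$ with the topology for which all the sets $\Delta(K,U,f,\theta_j,U_\nu)$ form a subbase. Then $\mathrm{Aut}_{\bar 0}(\mathcal M)$, with composition of automorphisms as multiplication and inversion of automorphisms as inverse, is a topological group: multiplication and inversion are continuous. -/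

import Mathlib

open TopologicalSpace CategoryTheory Opposite
open scoped Manifold ContDiff TensorProduct

universe u

noncomputable section

namespace Super

/-! ### Sheaves of superalgebras and their morphisms -/

/-- A sheaf of complex superalgebras on a topological space `M`: a sheaf of (not necessarily
commutative) `ℂ`-algebras together with a `ℤ/2`-grading of every algebra of sections that is
respected by the restriction maps. -/
structure SuperalgebraSheaf (M : Type u) [TopologicalSpace M] where
  sheaf : TopCat.Sheaf (AlgCat.{u} ℂ) (TopCat.of M)
  parity : ∀ U : Opens M, ZMod 2 → Submodule ℂ (sheaf.presheaf.obj (op U))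
  gradedMonoid : ∀ U : Opens M, SetLike.GradedMonoid (parity U)
  isInternal : ∀ U : Opens M, DirectSum.IsInternal (parity U)
  map_mem_parity : ∀ {U V : Opens M} (h : V ≤ U) (i : ZMod 2) (f : sheaf.presheaf.obj (op U)),
    f ∈ parity U i → (sheaf.presheaf.map (homOfLE h).op).hom f ∈ parity V i

namespace SuperalgebraSheaf

variable {M N P : Type u} [TopologicalSpace M] [TopologicalSpace N] [TopologicalSpace P]

/-- The algebra of sections over an open set. -/
abbrev Sections (A : SuperalgebraSheaf M) (U : Opens M) : Type u :=
  A.sheaf.presheaf.obj (op U)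

/-- The restriction of sections to a smaller open set. -/
def res (A : SuperalgebraSheaf M) {U V : Opens M} (h : V ≤ U) :
    A.Sections U →ₐ[ℂ] A.Sections V :=
  (A.sheaf.presheaf.map (homOfLE h).op).hom

/-- A morphism `(M, A) → (N, B)` of spaces with sheaves of superalgebras: a continuous map
`φ : M → N` together with a parity-preserving morphism `φ^* : B → φ_* A` of sheaves of
`ℂ`-algebras. -/
@[ext]
structure Hom (A : SuperalgebraSheaf M) (B : SuperalgebraSheaf N) where
  base : C(M, N)
  pullback : ∀ U : Opens N, B.Sections U →ₐ[ℂ] A.Sections (Opens.comap base U)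
  pullback_res : ∀ {U V : Opens N} (h : V ≤ U) (f : B.Sections U),
    pullback V (B.res h f) = A.res (Opens.comap_mono base h) (pullback U f)
  pullback_mem_parity : ∀ (U : Opens N) (i : ZMod 2) (f : B.Sections U),
    f ∈ B.parity U i → pullback U f ∈ A.parity (Opens.comap base U) i

namespace Hom

/-- The identity morphism. -/
def id (A : SuperalgebraSheaf M) : Hom A A where
  base := ContinuousMap.id M
  pullback U := AlgHom.id ℂ (A.Sections U)
  pullback_res _ _ := rfl
  pullback_mem_parity _ _ _ hf := hf

/-- The composition `φ ∘ ψ` of morphisms, with pullback `(φ ∘ ψ)^* = ψ^* ∘ φ^*`. -/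
def comp {A : SuperalgebraSheaf M} {B : SuperalgebraSheaf N} {C : SuperalgebraSheaf P}
    (φ : Hom B C) (ψ : Hom A B) : Hom A C where
  base := φ.base.comp ψ.base
  pullback U := (ψ.pullback (Opens.comap φ.base U)).comp (φ.pullback U)
  pullback_res {U V} h f := by
    have h₁ := congrArg (ψ.pullback (Opens.comap φ.base V)) (φ.pullback_res h f)
    exact h₁.trans (ψ.pullback_res (Opens.comap_mono φ.base h) (φ.pullback U f))
  pullback_mem_parity U i f hf :=
    ψ.pullback_mem_parity _ i _ (φ.pullback_mem_parity U i f hf)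

end Hom

/-- The automorphisms of `(M, A)`: morphisms `(M, A) → (M, A)` that have a two-sided inverse
morphism. -/
structure Aut (A : SuperalgebraSheaf M) where
  hom : Hom A A
  inv : Hom A A
  hom_comp_inv : hom.comp inv = Hom.id A
  inv_comp_hom : inv.comp hom = Hom.id A

namespace Aut

variable {A : SuperalgebraSheaf M}

/-- An automorphism is determined by its underlying morphism. -/
theorem ext {φ ψ : Aut A} (h : φ.hom = ψ.hom) : φ = ψ := by
  obtain ⟨f, g, h₁, h₂⟩ := φ
  obtain ⟨f', g', h₁', h₂'⟩ := ψ
  obtain rfl : f = f' := h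
  have : g = g' := by
    calc g = g.comp (f.comp g') := by rw [h₁']; rfl
      _ = (g.comp f).comp g' := rfl
      _ = g' := by rw [h₂]; rfl
  subst this
  rfl

instance : One (Aut A) := ⟨⟨Hom.id A, Hom.id A, rfl, rfl⟩⟩

instance : Inv (Aut A) := ⟨fun φ => ⟨φ.inv, φ.hom, φ.inv_comp_hom, φ.hom_comp_inv⟩⟩

instance : Mul (Aut A) where
  mul φ ψ :=
    { hom := φ.hom.comp ψ.hom
      inv := ψ.inv.comp φ.inv
      hom_comp_inv := by
        calc (φ.hom.comp ψ.hom).comp (ψ.inv.comp φ.inv)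
            = φ.hom.comp ((ψ.hom.comp ψ.inv).comp φ.inv) := rfl
          _ = φ.hom.comp φ.inv := by rw [ψ.hom_comp_inv]; rfl
          _ = Hom.id A := φ.hom_comp_inv
      inv_comp_hom := by
        calc (ψ.inv.comp φ.inv).comp (φ.hom.comp ψ.hom)
            = ψ.inv.comp ((φ.inv.comp φ.hom).comp ψ.hom) := rfl
          _ = ψ.inv.comp ψ.hom := by rw [φ.inv_comp_hom]; rfl
          _ = Hom.id A := ψ.inv_comp_hom }

theorem mul_hom (φ ψ : Aut A) : (φ * ψ).hom = φ.hom.comp ψ.hom := rfl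

theorem one_hom : (1 : Aut A).hom = Hom.id A := rfl

theorem inv_hom (φ : Aut A) : (φ⁻¹).hom = φ.inv := rfl

/-- The group of automorphisms, with composition as multiplication and inversion of automorphisms
as inverse. -/
instance : Group (Aut A) where
  mul_assoc _ _ _ := ext rfl
  one_mul _ := ext rfl
  mul_one _ := ext rfl
  inv_mul_cancel φ := ext (by rw [mul_hom, inv_hom, φ.inv_comp_hom, one_hom])

end Aut

end SuperalgebraSheaf

/-! ### The local model `𝒪 ⊗ ⋀ ℂⁿ` -/

section LocalModel

variable {m : ℕ} {M : Type u} [TopologicalSpace M] [ChartedSpace (EuclideanSpace ℂ (Fin m)) M]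

/-- The `ℂ`-algebra of holomorphic functions on an open subset `V` of the complex manifold `M`. -/
def Hol (m : ℕ) {M : Type u} [TopologicalSpace M] [ChartedSpace (EuclideanSpace ℂ (Fin m)) M]
    (V : Opens M) : Subalgebra ℂ (V → ℂ) where
  carrier := {f | MDifferentiable 𝓘(ℂ, EuclideanSpace ℂ (Fin m)) 𝓘(ℂ, ℂ) f}
  mul_mem' hf hg := hf.mul hg
  add_mem' hf hg := hf.add hg
  algebraMap_mem' _ := mdifferentiable_const

/-- The restriction of holomorphic functions to a smaller open set. -/
def Hol.res {U V : Opens M} (h : V ≤ U) : Hol m U →ₐ[ℂ] Hol m V where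
  toFun f := ⟨fun x => f.1 (Opens.inclusion h x), MDifferentiable.comp f.2
    ((contMDiff_inclusion (I := 𝓘(ℂ, EuclideanSpace ℂ (Fin m))) (n := 1) h).mdifferentiable
      one_ne_zero)⟩
  map_one' := rfl
  map_mul' _ _ := rfl
  map_zero' := rfl
  map_add' _ _ := rfl
  commutes' _ := rfl

/-- The sections over `V` of the sheaf `𝒪 ⊗ ⋀ ℂⁿ`. -/
abbrev Model (m n : ℕ) {M : Type u} [TopologicalSpace M]
    [ChartedSpace (EuclideanSpace ℂ (Fin m)) M] (V : Opens M) : Type u :=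
  Hol m V ⊗[ℂ] ExteriorAlgebra ℂ (Fin n → ℂ)

/-- The restriction maps of `𝒪 ⊗ ⋀ ℂⁿ`. -/
def Model.res {n : ℕ} {U V : Opens M} (h : V ≤ U) : Model m n U →ₐ[ℂ] Model m n V :=
  Algebra.TensorProduct.map (Hol.res h) (AlgHom.id ℂ (ExteriorAlgebra ℂ (Fin n → ℂ)))

/-- The even and the odd part of `𝒪(V) ⊗ ⋀ ℂⁿ`: holomorphic functions are even, and the elements
of `ℂⁿ` are odd. -/
def Model.parity (m n : ℕ) {M : Type u} [TopologicalSpace M]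
    [ChartedSpace (EuclideanSpace ℂ (Fin m)) M] (V : Opens M) (i : ZMod 2) :
    Submodule ℂ (Model m n V) :=
  LinearMap.range (LinearMap.lTensor (Hol m V)
    (CliffordAlgebra.evenOdd (0 : QuadraticForm ℂ (Fin n → ℂ)) i).subtype)

/-- The basis of `𝒪(V) ⊗ ⋀ ℂⁿ` over `𝒪(V)` that consists of the monomials
`θ^ν = θ_{j₁} ⋯ θ_{jₖ}`, `j₁ < ⋯ < jₖ`, in the standard basis `θ₁, …, θₙ` of `ℂⁿ`. The exponent
`ν ∈ (ℤ/2)ⁿ` is given by its support `{j₁, …, jₖ}`. -/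
def Model.basis (m n : ℕ) {M : Type u} [TopologicalSpace M]
    [ChartedSpace (EuclideanSpace ℂ (Fin m)) M] (V : Opens M) :
    Module.Basis (Finset (Fin n)) (Hol m V) (Model m n V) :=
  Algebra.TensorProduct.basis (Hol m V) (Pi.basisFun ℂ (Fin n)).ExteriorAlgebra

/-- An isomorphism `𝒪_W ⊗ ⋀ ℂⁿ ≅ A|_W` of sheaves of superalgebras on the open set `W`, where
`𝒪_W` is the sheaf of holomorphic functions on `W`. The images of the standard basis vectors of
`ℂⁿ` are the odd coordinates `θ₁, …, θₙ` on `W`. -/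
structure LocalTrivialization (m n : ℕ) {M : Type u} [TopologicalSpace M]
    [ChartedSpace (EuclideanSpace ℂ (Fin m)) M] (A : SuperalgebraSheaf M) (W : Opens M) where
  equiv : ∀ V : Opens M, V ≤ W → (Model m n V ≃ₐ[ℂ] A.Sections V)
  equiv_res : ∀ {V V' : Opens M} (hV : V ≤ W) (h : V' ≤ V) (a : Model m n V),
    equiv V' (h.trans hV) (Model.res h a) = A.res h (equiv V hV a)
  equiv_mem_parity : ∀ {V : Opens M} (hV : V ≤ W) (i : ZMod 2) (a : Model m n V),
    equiv V hV a ∈ A.parity V i ↔ a ∈ Model.parity m n V i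

/-- The coefficient function `f_ν ∈ 𝒪(V)` in the expansion `f = ∑ ν, f_ν θ^ν` of a section `f`
over `V ⊆ W` with respect to a local trivialization on `W`. -/
def LocalTrivialization.coeff {n : ℕ} {A : SuperalgebraSheaf M} {W : Opens M}
    (θ : LocalTrivialization m n A W) {V : Opens M} (hV : V ≤ W) (f : A.Sections V)
    (ν : Finset (Fin n)) : Hol m V :=
  (Model.basis m n V).repr ((θ.equiv V hV).symm f) ν

end LocalModel

/-! ### Complex supermanifolds and the topology on the automorphism group -/

/-- The structure sheaf of a complex supermanifold of dimension `(m|n)` with underlying complex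
manifold `M`: a sheaf of superalgebras on `M` that is locally isomorphic to `𝒪 ⊗ ⋀ ℂⁿ`. -/
structure ComplexSupermanifold (m n : ℕ) (M : Type u) [TopologicalSpace M]
    [ChartedSpace (EuclideanSpace ℂ (Fin m)) M] extends SuperalgebraSheaf M where
  locally_trivial : ∀ x : M, ∃ W : Opens M, x ∈ W ∧
    Nonempty (LocalTrivialization m n toSuperalgebraSheaf W)

namespace ComplexSupermanifold

variable {m n : ℕ} {M : Type u} [TopologicalSpace M] [ChartedSpace (EuclideanSpace ℂ (Fin m)) M]

/-- The group of automorphisms of a complex supermanifold. -/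
abbrev Aut (𝓜 : ComplexSupermanifold m n M) : Type u :=
  SuperalgebraSheaf.Aut 𝓜.toSuperalgebraSheaf

/-- The set `Δ(K, U, f, θ_j, G_ν)` of all automorphisms `φ` whose underlying map takes `K` into
`U`, and for which each coefficient function `φ_{f,ν}` of `φ^* f = ∑ ν, φ_{f,ν} θ^ν` takes `K`
into `G_ν`. The expansion is the one on `W ∩ φ⁻¹(U)`, a neighbourhood of `K` if `K ⊆ W`. -/
def subbasicSet (𝓜 : ComplexSupermanifold m n M) (K : Set M) (U : Opens M) (f : 𝓜.Sections U)
    {W : Opens M} (θ : LocalTrivialization m n 𝓜.toSuperalgebraSheaf W)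
    (G : Finset (Fin n) → Set ℂ) : Set 𝓜.Aut :=
  {φ | Set.MapsTo φ.hom.base K U ∧
    ∀ (ν : Finset (Fin n)) (x : ↥(W ⊓ Opens.comap φ.hom.base U)), (x : M) ∈ K →
      (θ.coeff (V := W ⊓ Opens.comap φ.hom.base U) inf_le_left
        (𝓜.res inf_le_right (φ.hom.pullback U f)) ν).1 x ∈ G ν}

/-- The topology on the automorphism group: the sets `Δ(K, U, f, θ_j, G_ν)`, with `K` compact and
contained in the domain `W` of the odd coordinates, `U` open, `f` a section over `U` and `G_ν` open
in `ℂ`, form a subbase. -/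
instance (𝓜 : ComplexSupermanifold m n M) : TopologicalSpace 𝓜.Aut :=
  TopologicalSpace.generateFrom
    {S | ∃ (K : Set M) (U W : Opens M) (f : 𝓜.Sections U)
      (θ : LocalTrivialization m n 𝓜.toSuperalgebraSheaf W) (G : Finset (Fin n) → Set ℂ),
      IsCompact K ∧ K ⊆ W ∧ (∀ ν, IsOpen (G ν)) ∧ S = 𝓜.subbasicSet K U f θ G}

end ComplexSupermanifold

end Super

end

/-!
The value of `φ^* f` at a point `x`, in odd coordinates near `x`, is an element of the
finite-dimensional algebra `⋀ ℂⁿ`. The topology on the automorphism group is the coarsest one for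
which the underlying maps and all these values are jointly continuous in `φ` and `x`: evaluation is
jointly continuous by `eventually_repr_value_mem`, since `M` is locally compact, and a map to the
group is continuous if the values are jointly continuous in the parameter and the point
(`continuousAt_of_value`), since the sets `K` are compact. So everything can be checked near a
point.

The main estimate is `exists_coeffNorm_value_le`: for `ψ` near `ψ₀` and `x` near `x₀`, the value of
`ψ^* h` at `x` is bounded by a constant times the supremum of the coefficients of `h` near `ψ₀ x₀`.
For fixed `ψ` and `x`, the map `h ↦ (ψ^* h)(x)` is a homomorphism from a stalk of `𝒪 ⊗ ⋀ ℂⁿ` to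
`⋀ ℂⁿ` (an `ExtPoint`). It takes a holomorphic function `u` to `u (ψ x)` modulo terms of positive
degree, because `u - c` is invertible near `ψ x` for every other constant `c`. Hadamard's lemma
writes `u` as `u (ψ x) + ∑ (z_i - z_i (ψ x)) u_i`, with bounds on the holomorphic functions `u_i`
that come from Cauchy's integral formula. The values of `z_i - z_i (ψ x)` have positive degree, and
products of more than `n` elements of positive degree vanish, so that after `n + 1` applications of
the lemma only finitely many terms remain, all of which are bounded.

For multiplication, `ψ^* φ^* f = ψ^* (φ^* f - φ₀^* f) + ψ^* φ₀^* f`. The first summand is small by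
the main estimate, and the second one is continuous in `ψ`. For inversion, translations reduce to
the identity. The section `h = φ⁻¹^* f - f` has the small pullback `φ^* h = f - φ^* f`, and so it has
to be shown that `h` is small if `φ^* h` is small and `φ` is near the identity. This is done by
induction on the degree (`exists_norm_repr_le_of_card_lt`): if the coefficients of degree less
than `k` are small, then these terms can be removed from `h` by the main estimate, and then `φ^*`
acts on the coefficients of degree `k` through a matrix close to the identity.
-/

noncomputable section

namespace Super

/-! ### The exterior algebra and its basis of monomials -/

/-- The exterior algebra `⋀ ℂⁿ`. -/
abbrev Ext (n : ℕ) : Type := ExteriorAlgebra ℂ (Fin n → ℂ)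

namespace Ext

variable {n : ℕ}

/-- The basis of `⋀ ℂⁿ` formed by the monomials `θ^ν`. -/
abbrev monomial (n : ℕ) : Module.Basis (Finset (Fin n)) ℂ (Ext n) :=
  (Pi.basisFun ℂ (Fin n)).ExteriorAlgebra

theorem monomial_mul_of_not_disjoint {μ ν : Finset (Fin n)} (h : ¬ Disjoint μ ν) :
    monomial n μ * monomial n ν = 0 :=
  ExteriorAlgebra.basis_mul_of_not_disjoint _ (⟨μ, rfl⟩ : Set.powersetCard (Fin n) μ.card)
    (⟨ν, rfl⟩ : Set.powersetCard (Fin n) ν.card) h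

theorem exists_monomial_mul_of_disjoint {μ ν : Finset (Fin n)} (h : Disjoint μ ν) :
    ∃ c : ℂ, ∃ ρ : Finset (Fin n), ρ.card = μ.card + ν.card ∧
      monomial n μ * monomial n ν = c • monomial n ρ := by
  let s : Set.powersetCard (Fin n) μ.card := ⟨μ, rfl⟩
  let t : Set.powersetCard (Fin n) ν.card := ⟨ν, rfl⟩
  have h' : Disjoint s.val t.val := h
  have key := ExteriorAlgebra.basis_mul_of_disjoint (Pi.basisFun ℂ (Fin n)) s t h'
  refine ⟨((Set.powersetCard.permOfDisjoint h').sign : ℤ), _,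
    (Set.powersetCard.disjUnion h').2, key.trans ?_⟩
  rw [Units.smul_def, ← Int.cast_smul_eq_zsmul ℂ]

theorem monomial_mem_exteriorPower (ν : Finset (Fin n)) :
    monomial n ν ∈ ⋀[ℂ]^ν.card (Fin n → ℂ) := by
  have := ExteriorAlgebra.basis_eq_coe_basis (Pi.basisFun ℂ (Fin n))
    (⟨ν, rfl⟩ : Set.powersetCard (Fin n) ν.card)
  rw [monomial]
  simp only at this
  rw [this]
  exact Subtype.property _

theorem monomial_empty : monomial n ∅ = 1 := by
  rw [monomial, ExteriorAlgebra.basis_apply_ofCard (n := 0) _ rfl]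
  simp

theorem repr_one (ν : Finset (Fin n)) :
    (monomial n).repr 1 ν = if ν = ∅ then 1 else 0 := by
  rw [← monomial_empty, Module.Basis.repr_self, Finsupp.single_apply]
  simp only [eq_comm]

/-! ### The norm of the exterior algebra -/

/-- The `ℓ¹`-norm with respect to the basis of monomials. -/
def coeffNorm (a : Ext n) : ℝ := ∑ ν, ‖(monomial n).repr a ν‖

theorem coeffNorm_nonneg (a : Ext n) : 0 ≤ coeffNorm a :=
  Finset.sum_nonneg fun _ _ => norm_nonneg _

@[simp] theorem coeffNorm_zero : coeffNorm (0 : Ext n) = 0 := by simp [coeffNorm]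

theorem coeffNorm_add_le (a b : Ext n) : coeffNorm (a + b) ≤ coeffNorm a + coeffNorm b := by
  simp only [coeffNorm, map_add, Finsupp.add_apply, ← Finset.sum_add_distrib]
  exact Finset.sum_le_sum fun _ _ => norm_add_le _ _

theorem coeffNorm_smul (c : ℂ) (a : Ext n) : coeffNorm (c • a) = ‖c‖ * coeffNorm a := by
  simp [coeffNorm, Finset.mul_sum]

theorem coeffNorm_sub_le (a b : Ext n) : coeffNorm (a - b) ≤ coeffNorm a + coeffNorm b := by
  have := coeffNorm_add_le a ((-1 : ℂ) • b)
  rw [coeffNorm_smul] at this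
  simpa [sub_eq_add_neg] using this

theorem coeffNorm_sub_comm (a b : Ext n) : coeffNorm (a - b) = coeffNorm (b - a) := by
  have := coeffNorm_smul (-1) (a - b)
  simpa using this.symm

theorem coeffNorm_sub_lt {a b c : Ext n} {ε : ℝ} (h1 : coeffNorm (a - c) < ε / 2)
    (h2 : coeffNorm (b - c) < ε / 2) : coeffNorm (a - b) < ε := by
  have := coeffNorm_sub_le (a - c) (b - c)
  rw [sub_sub_sub_cancel_right] at this
  linarith

theorem coeffNorm_sum_le {ι : Type*} (s : Finset ι) (f : ι → Ext n) :
    coeffNorm (∑ i ∈ s, f i) ≤ ∑ i ∈ s, coeffNorm (f i) :=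
  Finset.le_sum_of_subadditive coeffNorm coeffNorm_zero.le coeffNorm_add_le s f

theorem norm_repr_le (a : Ext n) (ν : Finset (Fin n)) :
    ‖(monomial n).repr a ν‖ ≤ coeffNorm a :=
  Finset.single_le_sum (f := fun ν => ‖(monomial n).repr a ν‖) (fun _ _ => norm_nonneg _)
    (Finset.mem_univ ν)

theorem coeffNorm_one : coeffNorm (1 : Ext n) = 1 := by
  simp [coeffNorm, repr_one, apply_ite]

theorem coeffNorm_mul_le (a b : Ext n) : coeffNorm (a * b) ≤
    (∑ μ, ∑ ν, coeffNorm (monomial n μ * monomial n ν)) * coeffNorm a * coeffNorm b := by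
  have key : a * b = ∑ μ, ∑ ν, ((monomial n).repr a μ * (monomial n).repr b ν) •
      (monomial n μ * monomial n ν) := by
    conv_lhs => rw [← (monomial n).sum_repr a, ← (monomial n).sum_repr b, Finset.sum_mul_sum]
    simp only [smul_mul_smul_comm]
  rw [key, Finset.sum_mul, Finset.sum_mul]
  refine (coeffNorm_sum_le _ _).trans (Finset.sum_le_sum fun μ _ => ?_)
  rw [Finset.sum_mul, Finset.sum_mul]
  refine (coeffNorm_sum_le _ _).trans (Finset.sum_le_sum fun ν _ => ?_)
  rw [coeffNorm_smul, norm_mul, mul_comm, mul_assoc]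
  exact mul_le_mul_of_nonneg_left (mul_le_mul (norm_repr_le a μ) (norm_repr_le b ν)
    (norm_nonneg _) (coeffNorm_nonneg _)) (coeffNorm_nonneg _)

theorem exists_coeffNorm_mul_le (n : ℕ) :
    ∃ D : ℝ, 0 ≤ D ∧ ∀ a b : Ext n, coeffNorm (a * b) ≤ D * coeffNorm a * coeffNorm b :=
  ⟨_, Finset.sum_nonneg fun _ _ => Finset.sum_nonneg fun _ _ => coeffNorm_nonneg _,
    coeffNorm_mul_le⟩

/-! ### The filtration of the exterior algebra by degree -/

/-- The subspace of `⋀ ℂⁿ` spanned by the monomials of degree at least `k`. -/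
def degreeGE (n k : ℕ) : Submodule ℂ (Ext n) where
  carrier := {a | ∀ ν : Finset (Fin n), ν.card < k → (monomial n).repr a ν = 0}
  zero_mem' _ _ := by simp
  add_mem' ha hb ν hν := by simp [ha ν hν, hb ν hν]
  smul_mem' c a ha ν hν := by simp [ha ν hν]

theorem mem_degreeGE_zero (a : Ext n) : a ∈ degreeGE n 0 := fun _ h => absurd h (Nat.not_lt_zero _)

theorem degreeGE_anti {k l : ℕ} (h : k ≤ l) : degreeGE n l ≤ degreeGE n k :=
  fun _ ha ν hν => ha ν (hν.trans_le h)

theorem eq_zero_of_mem_degreeGE {k : ℕ} (h : n < k) {a : Ext n} (ha : a ∈ degreeGE n k) :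
    a = 0 := by
  refine (monomial n).ext_elem fun ν => ?_
  rw [map_zero, Finsupp.zero_apply]
  exact ha ν (lt_of_le_of_lt (by simpa using Finset.card_le_univ ν) h)

theorem monomial_mem_degreeGE {k : ℕ} {ν : Finset (Fin n)} (h : k ≤ ν.card) :
    monomial n ν ∈ degreeGE n k := by
  intro ρ hρ
  rw [Module.Basis.repr_self, Finsupp.single_apply, if_neg]
  rintro rfl
  omega

theorem mul_mem_degreeGE {k l : ℕ} {a b : Ext n} (ha : a ∈ degreeGE n k) (hb : b ∈ degreeGE n l) :
    a * b ∈ degreeGE n (k + l) := by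
  rw [← (monomial n).sum_repr a, ← (monomial n).sum_repr b, Finset.sum_mul_sum]
  refine Submodule.sum_mem _ fun μ _ => Submodule.sum_mem _ fun ν _ => ?_
  rw [smul_mul_smul_comm]
  by_cases hμ : μ.card < k
  · simp [ha μ hμ]
  by_cases hν : ν.card < l
  · simp [hb ν hν]
  refine Submodule.smul_mem _ _ ?_
  by_cases hd : Disjoint μ ν
  · obtain ⟨c, ρ, hρ, h⟩ := exists_monomial_mul_of_disjoint hd
    rw [h]
    exact Submodule.smul_mem _ _ (monomial_mem_degreeGE (by omega))
  · rw [monomial_mul_of_not_disjoint hd]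
    exact zero_mem _

theorem pow_degreeGE_one_le (k : ℕ) : degreeGE n 1 ^ k ≤ degreeGE n k := by
  induction k with
  | zero => exact fun a _ => mem_degreeGE_zero a
  | succ k ih =>
    rw [pow_succ]
    exact Submodule.mul_le.2 fun a ha b hb => mul_mem_degreeGE (ih ha) hb

theorem sub_algebraMap_mem_degreeGE (a : Ext n) :
    a - algebraMap ℂ _ ((monomial n).repr a ∅) ∈ degreeGE n 1 := by
  intro ν hν
  obtain rfl : ν = ∅ := by simpa using hν
  rw [Algebra.algebraMap_eq_smul_one]
  simp [repr_one]

/-- The constant term is multiplicative. -/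
theorem repr_mul_empty (a b : Ext n) : (monomial n).repr (a * b) ∅ =
    (monomial n).repr a ∅ * (monomial n).repr b ∅ := by
  have ha := sub_algebraMap_mem_degreeGE a
  have hb := sub_algebraMap_mem_degreeGE b
  set α := (monomial n).repr a ∅
  set β := (monomial n).repr b ∅
  have h : a * b = (α * β) • 1 + (α • (b - algebraMap ℂ _ β) +
      (a - algebraMap ℂ _ α) * b) := by
    simp only [Algebra.algebraMap_eq_smul_one, smul_sub, sub_mul, smul_mul_assoc, one_mul,
      smul_smul]
    abel
  have h2 : (α • (b - algebraMap ℂ _ β) + (a - algebraMap ℂ _ α) * b) ∈ degreeGE n 1 :=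
    add_mem (Submodule.smul_mem _ _ hb) (mul_mem_degreeGE (l := 0) ha (mem_degreeGE_zero b))
  rw [h, map_add, Finsupp.add_apply, h2 ∅ (by simp)]
  simp [repr_one]

theorem repr_empty_ne_zero_of_isUnit {a : Ext n} (ha : IsUnit a) :
    (monomial n).repr a ∅ ≠ 0 := by
  obtain ⟨b, hb⟩ := ha.exists_right_inv
  intro h
  have := repr_mul_empty a b
  rw [hb, h, repr_one] at this
  simp at this

theorem mem_degreeGE_one_of_mul_self {a : Ext n} (ha : a * a = 0) : a ∈ degreeGE n 1 := by
  intro ν hν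
  obtain rfl : ν = ∅ := by simpa using hν
  have := repr_mul_empty a a
  simpa [ha] using this

/-- Every endomorphism of the algebra `⋀ ℂⁿ` preserves the filtration by degree, since the
images of the generators have square zero, hence no constant term. -/
theorem algHom_monomial_mem_degreeGE (g : Ext n →ₐ[ℂ] Ext n) (ν : Finset (Fin n)) :
    g (monomial n ν) ∈ degreeGE n ν.card := by
  have h1 : Submodule.map g.toLinearMap (LinearMap.range (ExteriorAlgebra.ι ℂ (M := Fin n → ℂ)))
      ≤ degreeGE n 1 := by
    rintro _ ⟨_, ⟨v, rfl⟩, rfl⟩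
    refine mem_degreeGE_one_of_mul_self ?_
    rw [AlgHom.toLinearMap_apply, ← map_mul, ExteriorAlgebra.ι_sq_zero, map_zero]
  have h2 : g (monomial n ν) ∈ Submodule.map g.toLinearMap (⋀[ℂ]^ν.card (Fin n → ℂ)) :=
    ⟨_, monomial_mem_exteriorPower ν, rfl⟩
  rw [ExteriorAlgebra.exteriorPower, Submodule.map_pow] at h2
  exact pow_degreeGE_one_le _ (pow_le_pow_left' h1 _ h2)

end Ext

/-! ### Hadamard's lemma with bounds on a polydisc -/

section Hadamard

open MeasureTheory Metric Filter Topology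

variable {m : ℕ}

theorem continuous_deriv_circleMap {c : ℂ} {R : ℝ} : Continuous (deriv (circleMap c R)) := by
  simp only [funext (deriv_circleMap c R)]
  fun_prop

/-- A circle integral that depends holomorphically on a parameter is holomorphic in it. -/
theorem differentiableAt_circleIntegral_of_param {F : (Fin m → ℂ) → ℂ → ℂ} {c : ℂ}
    {R M : ℝ} (hR : 0 ≤ R)
    {x : Fin m → ℂ} {δ : ℝ} (hδ : 0 < δ)
    (hd : ∀ w ∈ sphere c R, DifferentiableOn ℂ (F · w) (ball x δ))
    (hc : ∀ z ∈ ball x δ, ContinuousOn (F z) (sphere c R))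
    (hM : ∀ z ∈ ball x δ, ∀ w ∈ sphere c R, ‖F z w‖ ≤ M) :
    DifferentiableAt ℂ (fun z => ∮ w in C(c, R), F z w) x := by
  have hmem : ∀ t, circleMap c R t ∈ sphere c R := circleMap_mem_sphere c hR
  have hcont : ∀ z ∈ ball x δ, Continuous fun t => F z (circleMap c R t) := fun z hz =>
    (hc z hz).comp_continuous (continuous_circleMap c R) hmem
  have hball : ball x δ ∈ 𝓝 x := ball_mem_nhds x hδ
  have hfd : ∀ w ∈ sphere c R, HasFDerivAt (F · w) (fderiv ℂ (F · w) x) x := fun w hw =>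
    ((hd w hw).differentiableAt hball).hasFDerivAt
  have hM0 : 0 ≤ M := (norm_nonneg _).trans (hM x (mem_ball_self hδ) _ (hmem 0))
  -- Along each coordinate direction the derivative is a limit of continuous difference quotients.
  have hmeas : ∀ v : Fin m → ℂ,
      Measurable fun t : ℝ => fderiv ℂ (F · (circleMap c R t)) x v := by
    intro v
    obtain ⟨N, hN⟩ : ∃ N : ℕ, ∀ k : ℕ, x + ((k + N + 1 : ℕ) : ℂ)⁻¹ • v ∈ ball x δ := by
      have h : Tendsto (fun k : ℕ => x + ((k + 1 : ℕ) : ℂ)⁻¹ • v) atTop (𝓝 x) := by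
        have := ((tendsto_inv_atTop_nhds_zero_nat (𝕜 := ℂ)).comp
          (tendsto_add_atTop_nat 1)).smul_const v
        simpa using this.const_add x
      obtain ⟨N, hN⟩ := eventually_atTop.1 (h.eventually hball)
      exact ⟨N, fun k => hN (k + N) (Nat.le_add_left _ _)⟩
    refine measurable_of_tendsto_metrizable
      (f := fun (k : ℕ) t => ((k + N + 1 : ℕ) : ℂ) • (F (x + ((k + N + 1 : ℕ) : ℂ)⁻¹ • v)
        (circleMap c R t) - F x (circleMap c R t)))
      (fun k => Measurable.const_smul
        ((hcont _ (hN k)).sub (hcont x (mem_ball_self hδ))).measurable ((k + N + 1 : ℕ) : ℂ)) ?_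
    rw [tendsto_pi_nhds]
    intro t
    have hN' : Tendsto (fun k : ℕ => ‖((k + N + 1 : ℕ) : ℂ)‖) atTop atTop := by
      simp only [Complex.norm_natCast]
      exact tendsto_natCast_atTop_atTop.comp (tendsto_add_atTop_nat (N + 1))
    exact (hfd _ (hmem t)).lim v hN'
  have hmeas' : AEStronglyMeasurable (fun t : ℝ => deriv (circleMap c R) t •
      fderiv ℂ (F · (circleMap c R t)) x) (volume.restrict (Set.uIoc 0 (2 * Real.pi))) := by
    have h : ∀ L : (Fin m → ℂ) →L[ℂ] ℂ, L =
        ∑ i, (L (Pi.single i 1)) • (ContinuousLinearMap.proj i : (Fin m → ℂ) →L[ℂ] ℂ) := by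
      intro L
      ext v
      conv_lhs => rw [pi_eq_sum_univ' v, map_sum]
      simp [mul_comm]
    refine AEStronglyMeasurable.smul continuous_deriv_circleMap.aestronglyMeasurable ?_
    rw [show (fun t : ℝ => fderiv ℂ (F · (circleMap c R t)) x) = fun t =>
      ∑ i, (fderiv ℂ (F · (circleMap c R t)) x (Pi.single i 1)) •
        (ContinuousLinearMap.proj i : (Fin m → ℂ) →L[ℂ] ℂ) from funext fun t => h _]
    refine Finset.aestronglyMeasurable_fun_sum _ fun i _ => ?_
    exact ((hmeas _).aestronglyMeasurable).smul_const _
  have hsub : ∀ z ∈ ball x (δ / 2), ball z (δ / 2) ⊆ ball x δ := fun z hz =>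
    ball_subset_ball' (by rw [mem_ball] at hz; linarith)
  have hhalf : ball x (δ / 2) ⊆ ball x δ := ball_subset_ball (by linarith)
  have hbound : ∀ w ∈ sphere c R, ∀ z ∈ ball x (δ / 2),
      ‖fderiv ℂ (F · w) z‖ ≤ (2 * M) / (δ / 2) := by
    intro w hw z hz
    refine Complex.norm_fderiv_le_div_of_mapsTo_ball ((hd w hw).mono (hsub z hz)) ?_ (half_pos hδ)
    intro z' hz'
    rw [mem_closedBall, dist_eq_norm]
    refine (norm_sub_le _ _).trans ?_
    linarith [hM z' (hsub z hz hz') w hw, hM z (hhalf hz) w hw]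
  refine (intervalIntegral.hasFDerivAt_integral_of_dominated_of_fderiv_le
    (F := fun z t => deriv (circleMap c R) t • F z (circleMap c R t)) (x₀ := x)
    (F' := fun z t => deriv (circleMap c R) t • fderiv ℂ (F · (circleMap c R t)) z)
    (a := 0) (b := 2 * Real.pi) (μ := volume) (bound := fun _ => |R| * ((2 * M) / (δ / 2)))
    (ball_mem_nhds x (half_pos hδ)) ?_ ?_ hmeas' ?_ intervalIntegrable_const ?_).differentiableAt
  · filter_upwards [hball] with z hz
    exact ((continuous_deriv_circleMap.smul (hcont z hz))).aestronglyMeasurable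
  · exact (continuous_deriv_circleMap.smul (hcont x (mem_ball_self hδ))).intervalIntegrable _ _
  · refine Eventually.of_forall fun t _ z hz => ?_
    rw [norm_smul]
    refine mul_le_mul (le_of_eq (by simp)) (hbound _ (hmem t) z hz) (norm_nonneg _) (abs_nonneg _)
  · refine Eventually.of_forall fun t _ z hz => ?_
    exact (((hd _ (hmem t)).differentiableAt
      (isOpen_ball.mem_nhds (hhalf hz))).hasFDerivAt).fun_const_smul _

/-- The one-variable case: the difference of the Cauchy integral formulas for two values. -/
theorem sub_eq_mul_circleIntegral {v : ℂ → ℂ} {c b : ℂ} {R : ℝ} (hR : 0 < R)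
    (hv : DifferentiableOn ℂ v (closedBall c R)) (hb : b ∈ ball c R) :
    v b - v c = (b - c) * ((2 * Real.pi * Complex.I)⁻¹ *
      ∮ w in C(c, R), (w - c)⁻¹ * (w - b)⁻¹ * v w) := by
  have hpi : (2 * Real.pi * Complex.I : ℂ) ≠ 0 := Complex.two_pi_I_ne_zero
  have h1 := hv.circleIntegral_sub_inv_smul hb
  have h2 := hv.circleIntegral_sub_inv_smul (mem_ball_self hR : c ∈ ball c R)
  have hne : ∀ a ∈ ball c R, ∀ w ∈ sphere c R, w - a ≠ 0 := by
    rintro a ha w hw h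
    rw [sub_eq_zero.1 h, mem_sphere] at hw
    exact absurd (mem_ball.1 ha) (by linarith)
  have hint : ∀ a ∈ ball c R, CircleIntegrable (fun w => (w - a)⁻¹ • v w) c R := fun a ha =>
    ContinuousOn.circleIntegrable hR.le (((continuousOn_id.sub continuousOn_const).inv₀
      (hne a ha)).smul (hv.continuousOn.mono sphere_subset_closedBall))
  have h3 : (∮ w in C(c, R), (w - b)⁻¹ • v w) - (∮ w in C(c, R), (w - c)⁻¹ • v w) =
      (b - c) * ∮ w in C(c, R), (w - c)⁻¹ * (w - b)⁻¹ * v w := by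
    rw [← circleIntegral.integral_sub (hint b hb) (hint c (mem_ball_self hR)), ← smul_eq_mul,
      ← circleIntegral.integral_smul]
    refine circleIntegral.integral_congr hR.le fun w hw => ?_
    have hb' := hne b hb w hw
    have hc' := hne c (mem_ball_self hR) w hw
    simp only [smul_eq_mul]
    field_simp
    ring
  rw [h1, h2, smul_eq_mul, smul_eq_mul, ← mul_sub] at h3
  rw [mul_left_comm, ← h3, inv_mul_cancel_left₀ hpi]

/-- **Hadamard's lemma** on a polydisc: a holomorphic function is its value at the centre plus a
linear combination of the coordinates, with holomorphic coefficients that are bounded by a multiple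
of the supremum of the function. The coefficients are Cauchy integrals. -/
theorem exists_hadamard_quotients {y : Fin m → ℂ} {ρ : ℝ} (hρ : 0 < ρ) {u : (Fin m → ℂ) → ℂ}
    (hu : DifferentiableOn ℂ u (ball y ρ)) {ε : ℝ} (hε : ∀ z ∈ ball y ρ, ‖u z‖ ≤ ε) :
    ∃ q : Fin m → (Fin m → ℂ) → ℂ, (∀ i, DifferentiableOn ℂ (q i) (ball y (ρ / 2))) ∧
      (∀ i, ∀ z ∈ ball y (ρ / 2), ‖q i z‖ ≤ 4 / ρ * ε) ∧
      ∀ z ∈ ball y (ρ / 2), u z = u y + ∑ i, (z i - y i) * q i z := by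
  have hε0 : 0 ≤ ε := (norm_nonneg _).trans (hε y (mem_ball_self hρ))
  -- the radius of the circles of integration, between `ρ / 2` and `ρ`
  set R : ℝ := 3 * ρ / 4 with hRdef
  have hR : 0 < R := by positivity
  have hRρ : R < ρ := by rw [hRdef]; linarith
  -- the path from `z` to `y` along the coordinate axes, replacing one coordinate after the other
  let s : Fin m → (Fin m → ℂ) → ℂ → Fin m → ℂ := fun i z w j =>
    if j < i then y j else if j = i then w else z j
  have hs : ∀ i, ∀ z ∈ ball y ρ, ∀ w ∈ ball (y i) ρ, s i z w ∈ ball y ρ := by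
    intro i z hz w hw
    rw [mem_ball, dist_pi_lt_iff hρ] at hz ⊢
    intro j
    simp only [s]
    split_ifs with h1 h2
    · simpa using hρ
    · subst h2; exact hw
    · exact hz j
  have hρ2 : ball y (ρ / 2) ⊆ ball y ρ := ball_subset_ball (by linarith)
  have hcoord : ∀ z ∈ ball y (ρ / 2), ∀ i, z i ∈ ball (y i) (ρ / 2) := fun z hz i =>
    lt_of_le_of_lt (dist_le_pi_dist z y i) hz
  have hw_ball : ∀ i, ∀ w ∈ closedBall (y i) R, w ∈ ball (y i) ρ := fun i w hw =>
    lt_of_le_of_lt hw hRρ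
  have hw1 : ∀ i, ∀ w ∈ sphere (y i) R, ‖(w - y i)⁻¹‖ = R⁻¹ := by
    intro i w hw
    rw [norm_inv, ← dist_eq_norm, mem_sphere.1 hw]
  have hw2' : ∀ i, ∀ z ∈ ball y (ρ / 2), ∀ w ∈ sphere (y i) R, ρ / 4 ≤ ‖w - z i‖ := by
    intro i z hz w hw
    have h1 := dist_triangle w (z i) (y i)
    have h2 := mem_ball.1 (hcoord z hz i)
    rw [mem_sphere.1 hw, dist_eq_norm w] at h1
    rw [hRdef] at h1
    linarith
  have hw2 : ∀ i, ∀ z ∈ ball y (ρ / 2), ∀ w ∈ sphere (y i) R, ‖(w - z i)⁻¹‖ ≤ 4 / ρ := by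
    intro i z hz w hw
    rw [norm_inv, ← inv_div]
    exact inv_anti₀ (by positivity) (hw2' i z hz w hw)
  have hFbound : ∀ i, ∀ z ∈ ball y (ρ / 2), ∀ w ∈ sphere (y i) R,
      ‖(w - y i)⁻¹ * (w - z i)⁻¹ * u (s i z w)‖ ≤ R⁻¹ * (4 / ρ) * ε := by
    intro i z hz w hw
    rw [norm_mul, norm_mul, hw1 i w hw]
    have h3 := hε _ (hs i z (hρ2 hz) w (hw_ball i w (sphere_subset_closedBall hw)))
    gcongr
    exact hw2 i z hz w hw
  have hsz : ∀ i w, Differentiable ℂ fun z => s i z w := by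
    intro i w
    rw [differentiable_pi]
    intro j
    simp only [s]
    split_ifs <;> fun_prop
  have hsw : ∀ i z, Differentiable ℂ fun w => s i z w := by
    intro i z
    rw [differentiable_pi]
    intro j
    simp only [s]
    split_ifs <;> fun_prop
  refine ⟨fun i z => (2 * Real.pi * Complex.I)⁻¹ *
    ∮ w in C(y i, R), (w - y i)⁻¹ * (w - z i)⁻¹ * u (s i z w), ?_, ?_, ?_⟩
  · intro i x hx
    obtain ⟨δ, hδ, hball⟩ := Metric.isOpen_iff.1 isOpen_ball x hx
    refine (DifferentiableAt.const_mul (differentiableAt_circleIntegral_of_param hR.le hδ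
      (M := R⁻¹ * (4 / ρ) * ε) ?_ ?_ ?_) _).differentiableWithinAt
    · intro w hw
      refine DifferentiableOn.mul (DifferentiableOn.mul (differentiableOn_const _) ?_) ?_
      · refine DifferentiableOn.inv (by fun_prop) fun z hz h => ?_
        have := hw2' i z (hball hz) w hw
        rw [h, norm_zero] at this
        linarith
      · exact hu.comp (hsz i w).differentiableOn fun z hz =>
          hs i z (hρ2 (hball hz)) w (hw_ball i w (sphere_subset_closedBall hw))
    · intro z hz
      refine ContinuousOn.mul (ContinuousOn.mul ?_ ?_) ?_
      · refine ContinuousOn.inv₀ (by fun_prop) fun w hw h => ?_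
        rw [sub_eq_zero.1 h, mem_sphere, dist_self] at hw
        exact hR.ne hw
      · refine ContinuousOn.inv₀ (by fun_prop) fun w hw h => ?_
        have := hw2' i z (hball hz) w hw
        rw [h, norm_zero] at this
        linarith
      · exact hu.continuousOn.comp (hsw i z).continuous.continuousOn fun w hw =>
          hs i z (hρ2 (hball hz)) w (hw_ball i w (sphere_subset_closedBall hw))
    · exact fun z hz w hw => hFbound i z (hball hz) w hw
  · intro i z hz
    have h := circleIntegral.norm_two_pi_i_inv_smul_integral_le_of_norm_le_const hR.le
      (hFbound i z hz)
    rw [smul_eq_mul] at h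
    refine h.trans (le_of_eq ?_)
    field_simp
  · intro z hz
    -- the intermediate points of the path
    let p : ℕ → Fin m → ℂ := fun k j => if (j : ℕ) < k then y j else z j
    have hp0 : p 0 = z := by simp [p]
    have hpm : p m = y := by ext j; simp [p]
    have hps : ∀ i : Fin m, s i z (z i) = p i := by
      intro i
      ext j
      simp only [s, p, ← Fin.lt_def]
      split_ifs with h1 h2
      · rfl
      · rw [h2]
      · rfl
    have hps' : ∀ i : Fin m, s i z (y i) = p (i + 1) := by
      intro i
      ext j
      simp only [s, p, Nat.lt_succ_iff, ← Fin.le_def]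
      split_ifs with h1 h2 h3 h4 h5
      · rfl
      · exact absurd h1.le h2
      · rw [h3]
      · exact absurd h3.le h4
      · exact absurd (lt_of_le_of_ne h5 h3) h1
      · rfl
    have htel : u z - u y = ∑ i : Fin m, (u (p i) - u (p (i + 1))) := by
      rw [Fin.sum_univ_eq_sum_range (fun k => u (p k) - u (p (k + 1))) m,
        Finset.sum_range_sub' (fun k => u (p k)), hp0, hpm]
    rw [← sub_eq_iff_eq_add', htel]
    refine Finset.sum_congr rfl fun i _ => ?_
    rw [← hps i, ← hps' i]
    refine sub_eq_mul_circleIntegral hR (v := fun w => u (s i z w)) ?_ ?_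
    · exact hu.comp (hsw i z).differentiableOn fun w hw => hs i z (hρ2 hz) w (hw_ball i w hw)
    · refine ball_subset_ball ?_ (hcoord z hz i)
      rw [hRdef]; linarith

end Hadamard

/-! ### Holomorphic functions in local coordinates -/

section Coordinates

open Metric Filter Topology

variable {m : ℕ} {M : Type u} [TopologicalSpace M] [ChartedSpace (EuclideanSpace ℂ (Fin m)) M]

theorem mdifferentiableAt_subtype_iff {V : Opens M} {f : M → ℂ} {x : V} :
    MDifferentiableAt 𝓘(ℂ, EuclideanSpace ℂ (Fin m)) 𝓘(ℂ, ℂ) (fun x : V => f x) x ↔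
      MDifferentiableAt 𝓘(ℂ, EuclideanSpace ℂ (Fin m)) 𝓘(ℂ, ℂ) f (x : M) := by
  exact ((differentiableWithinAt_localInvariantProp (I := 𝓘(ℂ, EuclideanSpace ℂ (Fin m)))
    (I' := 𝓘(ℂ, ℂ))).liftPropAt_iff_comp_subtype_val f x).symm

theorem Hol.mem_of_mdifferentiableAt {V : Opens M} {f : M → ℂ}
    (hf : ∀ x ∈ V, MDifferentiableAt 𝓘(ℂ, EuclideanSpace ℂ (Fin m)) 𝓘(ℂ, ℂ) f x) :
    (fun x : V => f x) ∈ Hol m V :=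
  fun x => mdifferentiableAt_subtype_iff.2 (hf x x.2)

theorem Hol.mdifferentiableAt {V : Opens M} (u : Hol m V) {f : M → ℂ} (hf : ∀ x : V, f x = u.1 x)
    {x : M} (hx : x ∈ V) : MDifferentiableAt 𝓘(ℂ, EuclideanSpace ℂ (Fin m)) 𝓘(ℂ, ℂ) f x := by
  have h := u.2 ⟨x, hx⟩
  rw [← (funext hf : (fun x : V => f x) = u.1)] at h
  exact mdifferentiableAt_subtype_iff.1 h

theorem Hol.continuous {V : Opens M} (u : Hol m V) : Continuous u.1 :=
  MDifferentiable.continuous u.2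

/-- Evaluation of holomorphic functions at a point. -/
def Hol.eval {V : Opens M} (x : M) (hx : x ∈ V) : Hol m V →ₐ[ℂ] ℂ :=
  (Pi.evalAlgHom ℂ (fun _ : V => ℂ) ⟨x, hx⟩).comp (Hol m V).val

@[simp] theorem Hol.eval_apply {V : Opens M} {x : M} (hx : x ∈ V) (u : Hol m V) :
    Hol.eval x hx u = u.1 ⟨x, hx⟩ := rfl

theorem Hol.isUnit_of_forall_ne_zero {V : Opens M} (u : Hol m V) (hu : ∀ x, u.1 x ≠ 0) :
    IsUnit u := by
  refine IsUnit.of_mul_eq_one ⟨fun x => (u.1 x)⁻¹, fun x => ?_⟩ ?_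
  · exact ((differentiableAt_inv (hu x)).mdifferentiableAt).comp x (u.2 x)
  · ext x
    exact mul_inv_cancel₀ (hu x)

/-- The preferred chart at a point, with values in `ℂᵐ` with the supremum norm, so that balls are
polydiscs. -/
def coordChart (y₀ : M) : OpenPartialHomeomorph M (Fin m → ℂ) :=
  (chartAt (EuclideanSpace ℂ (Fin m)) y₀).transHomeomorph
    (EuclideanSpace.equiv (Fin m) ℂ).toHomeomorph

theorem mem_coordChart_source (y₀ : M) : y₀ ∈ (coordChart (m := m) y₀).source :=
  mem_chart_source _ y₀

/-- The domain of the coordinates at `y₀`. -/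
def coordDomain (m : ℕ) {M : Type u} [TopologicalSpace M]
    [ChartedSpace (EuclideanSpace ℂ (Fin m)) M] (y₀ : M) : Opens M :=
  ⟨(coordChart (m := m) y₀).source, (coordChart y₀).open_source⟩

/-- The polydisc with centre `y` and radius `ρ` in the coordinates at `y₀`. -/
def polydisc (m : ℕ) {M : Type u} [TopologicalSpace M]
    [ChartedSpace (EuclideanSpace ℂ (Fin m)) M] (y₀ y : M) (ρ : ℝ) : Opens M :=
  ⟨(coordChart (m := m) y₀).source ∩ coordChart (m := m) y₀ ⁻¹' ball (coordChart y₀ y) ρ,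
    (coordChart y₀).isOpen_inter_preimage isOpen_ball⟩

variable {y₀ : M}

theorem mem_polydisc_self {y : M} (hy : y ∈ coordDomain m y₀) {ρ : ℝ} (hρ : 0 < ρ) :
    y ∈ polydisc m y₀ y ρ := ⟨hy, mem_ball_self hρ⟩

theorem polydisc_mono {y : M} {ρ ρ' : ℝ} (h : ρ ≤ ρ') : polydisc m y₀ y ρ ≤ polydisc m y₀ y ρ' :=
  fun _ hx => ⟨hx.1, ball_subset_ball h hx.2⟩

theorem polydisc_le_coordDomain {y : M} {ρ : ℝ} : polydisc m y₀ y ρ ≤ coordDomain m y₀ :=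
  fun _ hx => hx.1

variable [IsManifold 𝓘(ℂ, EuclideanSpace ℂ (Fin m)) 1 M]

theorem mdifferentiableAt_coordChart {x : M} (hx : x ∈ coordDomain m y₀) :
    MDifferentiableAt 𝓘(ℂ, EuclideanSpace ℂ (Fin m)) 𝓘(ℂ, Fin m → ℂ) (coordChart (m := m) y₀) x :=
  ((EuclideanSpace.equiv (Fin m) ℂ).differentiableAt.mdifferentiableAt).comp x
    ((mdifferentiable_chart (I := 𝓘(ℂ, EuclideanSpace ℂ (Fin m))) y₀).mdifferentiableAt hx)

theorem mdifferentiableAt_coordChart_symm {p : Fin m → ℂ}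
    (hp : p ∈ (coordChart (M := M) y₀).target) :
    MDifferentiableAt 𝓘(ℂ, Fin m → ℂ) 𝓘(ℂ, EuclideanSpace ℂ (Fin m))
      (coordChart (M := M) y₀).symm p :=
  ((mdifferentiable_chart (I := 𝓘(ℂ, EuclideanSpace ℂ (Fin m))) y₀).mdifferentiableAt_symm
    hp).comp p ((EuclideanSpace.equiv (Fin m) ℂ).symm.differentiableAt.mdifferentiableAt)

/-- The coordinate functions. -/
def Hol.coord (y₀ : M) {V : Opens M} (hV : V ≤ coordDomain m y₀) (i : Fin m) : Hol m V :=
  ⟨fun x => coordChart y₀ x i, Hol.mem_of_mdifferentiableAt (f := fun x => coordChart y₀ x i)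
    fun x hx => ((differentiableAt_apply i _).mdifferentiableAt).comp x
      (mdifferentiableAt_coordChart (hV hx))⟩

/-- **Hadamard's lemma** for holomorphic functions on a polydisc in a complex manifold. -/
theorem Hol.exists_hadamard_quotients {y : M} {ρ : ℝ} (hy : y ∈ coordDomain m y₀) (hρ : 0 < ρ)
    (hball : ball (coordChart y₀ y) ρ ⊆ (coordChart (m := m) y₀).target)
    (u : Hol m (polydisc m y₀ y ρ)) {ε : ℝ} (hε : ∀ x, ‖u.1 x‖ ≤ ε) :
    ∃ q : Fin m → Hol m (polydisc m y₀ y (ρ / 2)), (∀ i x, ‖(q i).1 x‖ ≤ 4 / ρ * ε) ∧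
      Hol.res (polydisc_mono (by linarith)) u = algebraMap ℂ _ (u.1 ⟨y, mem_polydisc_self hy hρ⟩) +
        ∑ i, (Hol.coord y₀ polydisc_le_coordDomain i -
          algebraMap ℂ _ (coordChart y₀ y i)) * q i := by
  classical
  let z := coordChart (m := m) y₀
  let f : M → ℂ := fun x => if hx : x ∈ polydisc m y₀ y ρ then u.1 ⟨x, hx⟩ else 0
  have hf : ∀ x : polydisc m y₀ y ρ, f x = u.1 x := fun x => dif_pos x.2
  have hmem : ∀ p ∈ ball (z y) ρ, z.symm p ∈ polydisc m y₀ y ρ := fun p hp =>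
    ⟨z.map_target (hball hp), by
      change z (z.symm p) ∈ ball (z y) ρ
      rwa [z.right_inv (hball hp)]⟩
  have hd : DifferentiableOn ℂ (fun p => f (z.symm p)) (ball (z y) ρ) := by
    intro p hp
    have h1 : MDifferentiableAt 𝓘(ℂ, Fin m → ℂ) 𝓘(ℂ, ℂ) (fun p => f (z.symm p)) p :=
      (Hol.mdifferentiableAt u hf (hmem p hp)).comp p (mdifferentiableAt_coordChart_symm (hball hp))
    exact h1.differentiableAt.differentiableWithinAt
  obtain ⟨q, hq1, hq2, hq3⟩ := Super.exists_hadamard_quotients hρ hd (ε := ε) (fun p hp => by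
    rw [hf ⟨_, hmem p hp⟩]; exact hε _)
  refine ⟨fun i => ⟨fun x => q i (z x), Hol.mem_of_mdifferentiableAt (f := fun x => q i (z x))
    fun x hx => (((hq1 i).differentiableAt (isOpen_ball.mem_nhds hx.2)).mdifferentiableAt).comp x
      (mdifferentiableAt_coordChart hx.1)⟩, fun i x => hq2 i _ x.2.2, ?_⟩
  refine Subtype.ext (funext fun x => ?_)
  have hx := hq3 (z x) x.2.2
  have hxρ : (x : M) ∈ polydisc m y₀ y ρ := polydisc_mono (by linarith) x.2
  have h1 : f (z.symm (z x)) = u.1 ⟨x, hxρ⟩ := by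
    rw [z.left_inv x.2.1]; exact hf ⟨x, hxρ⟩
  have h2 : f (z.symm (z y)) = u.1 ⟨y, mem_polydisc_self hy hρ⟩ := by
    rw [z.left_inv hy]; exact hf ⟨y, mem_polydisc_self hy hρ⟩
  rw [h1, h2] at hx
  refine Eq.trans hx ?_
  have h3 := map_sum (Hol.eval (m := m) (x : M) x.2) (fun i =>
    (Hol.coord y₀ polydisc_le_coordDomain i - algebraMap ℂ _ (coordChart y₀ y i)) *
      (⟨fun x => q i (z x), Hol.mem_of_mdifferentiableAt (f := fun x => q i (z x))
    fun x hx => (((hq1 i).differentiableAt (isOpen_ball.mem_nhds hx.2)).mdifferentiableAt).comp x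
      (mdifferentiableAt_coordChart hx.1)⟩ : Hol m (polydisc m y₀ y (ρ / 2)))) Finset.univ
  exact congrArg _ h3.symm

end Coordinates

/-! ### Points of the local model with values in `⋀ ℂⁿ` -/

section Points

open Metric Filter Topology

variable {m n : ℕ} {M : Type u} [TopologicalSpace M] [ChartedSpace (EuclideanSpace ℂ (Fin m)) M]

/-- The homomorphism `𝒪(V) ⊗ ⋀ ℂⁿ → ⋀ ℂⁿ` that evaluates the coefficients at a point. -/
def Model.eval {V : Opens M} (x : M) (hx : x ∈ V) : Model m n V →ₐ[ℂ] Ext n :=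
  Algebra.TensorProduct.lift ((Algebra.ofId ℂ (Ext n)).comp (Hol.eval x hx)) (AlgHom.id ℂ _)
    fun f g => Algebra.commutes (A := Ext n) (f.1 ⟨x, hx⟩) g

theorem Model.eval_tmul {V : Opens M} {x : M} (hx : x ∈ V) (f : Hol m V) (b : Ext n) :
    Model.eval (n := n) x hx (f ⊗ₜ b) = f.1 ⟨x, hx⟩ • b := by
  rw [Algebra.smul_def]
  exact Algebra.TensorProduct.lift_tmul _ _ _ _ _

theorem Model.eval_res {U V : Opens M} (h : V ≤ U) {x : M} (hx : x ∈ V) (a : Model m n U) :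
    Model.eval (n := n) (m := m) x hx (Model.res h a) = Model.eval x (h hx) a := by
  have : (Model.eval (n := n) (m := m) x hx).comp (Model.res h) = Model.eval x (h hx) := by
    refine Algebra.TensorProduct.ext' fun f g => ?_
    rw [AlgHom.comp_apply, Model.res, Algebra.TensorProduct.map_tmul, Model.eval_tmul,
      Model.eval_tmul]
    rfl
  exact DFunLike.congr_fun this a

theorem Model.basis_apply {V : Opens M} (ν : Finset (Fin n)) :
    Model.basis m n V ν = 1 ⊗ₜ[ℂ] Ext.monomial n ν :=
  Algebra.TensorProduct.basis_apply _ _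

/-- The expansion `a = ∑ ν, a_ν θ^ν`. -/
theorem Model.eq_sum {V : Opens M} (a : Model m n V) :
    a = ∑ ν, ((Model.basis m n V).repr a ν ⊗ₜ[ℂ] 1) * (1 ⊗ₜ[ℂ] Ext.monomial n ν) := by
  conv_lhs => rw [← (Model.basis m n V).sum_repr a]
  refine Finset.sum_congr rfl fun ν _ => ?_
  rw [Model.basis_apply, TensorProduct.smul_tmul', Algebra.TensorProduct.tmul_mul_tmul, smul_eq_mul,
    one_mul]

theorem Model.repr_eval {V : Opens M} {x : M} (hx : x ∈ V) (a : Model m n V) (ν : Finset (Fin n)) :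
    (Ext.monomial n).repr (Model.eval x hx a) ν = ((Model.basis m n V).repr a ν).1 ⟨x, hx⟩ := by
  have h : Model.eval x hx a =
      ∑ μ, ((Model.basis m n V).repr a μ).1 ⟨x, hx⟩ • Ext.monomial n μ := by
    conv_lhs => rw [Model.eq_sum a, map_sum]
    refine Finset.sum_congr rfl fun μ _ => ?_
    rw [Algebra.TensorProduct.tmul_mul_tmul, mul_one, one_mul, Model.eval_tmul]
  rw [h, Module.Basis.repr_sum_self]

/-- A point of the superspace `(W, 𝒪_W ⊗ ⋀ ℂⁿ)` over `y` with values in `⋀ ℂⁿ`: a homomorphism to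
`⋀ ℂⁿ` from the stalk at `y`, given by a compatible family of homomorphisms from the algebras of
sections over the neighbourhoods of `y` in `W`. -/
structure ExtPoint (m n : ℕ) {M : Type u} [TopologicalSpace M]
    [ChartedSpace (EuclideanSpace ℂ (Fin m)) M] (W : Opens M) (y : M) where
  toHom : ∀ V : Opens M, y ∈ V → V ≤ W → (Model m n V →ₐ[ℂ] Ext n)
  toHom_res : ∀ {U V : Opens M} (hy : y ∈ V) (h : V ≤ U) (hU : U ≤ W) (a : Model m n U),
    toHom V hy (h.trans hU) (Model.res h a) = toHom U (h hy) hU a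

namespace ExtPoint

variable {W : Opens M} {y : M} (χ : ExtPoint m n W y)

/-- The value of a holomorphic function at a point with values in `⋀ ℂⁿ`. -/
def onHol {V : Opens M} (hy : y ∈ V) (hV : V ≤ W) : Hol m V →ₐ[ℂ] Ext n :=
  (χ.toHom V hy hV).comp Algebra.TensorProduct.includeLeft

theorem onHol_res {U V : Opens M} (hy : y ∈ V) (h : V ≤ U) (hU : U ≤ W) (u : Hol m U) :
    χ.onHol hy (h.trans hU) (Hol.res h u) = χ.onHol (h hy) hU u := by
  have := χ.toHom_res hy h hU (u ⊗ₜ 1)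
  rw [Model.res, Algebra.TensorProduct.map_tmul, map_one] at this
  exact this

/-- The values of the elements of `⋀ ℂⁿ` at a point with values in `⋀ ℂⁿ`. -/
def onExt (hy : y ∈ W) : Ext n →ₐ[ℂ] Ext n :=
  (χ.toHom W hy le_rfl).comp Algebra.TensorProduct.includeRight

theorem toHom_one_tmul {V : Opens M} (hy : y ∈ V) (hV : V ≤ W) (b : Ext n) :
    χ.toHom V hy hV (1 ⊗ₜ b) = χ.onExt (hV hy) b := by
  have := χ.toHom_res hy hV le_rfl (1 ⊗ₜ b)
  simpa [Model.res, onExt] using this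

theorem toHom_eq_sum {V : Opens M} (hy : y ∈ V) (hV : V ≤ W) (a : Model m n V) :
    χ.toHom V hy hV a = ∑ ν, χ.onHol hy hV ((Model.basis m n V).repr a ν) *
      χ.onExt (hV hy) (Ext.monomial n ν) := by
  conv_lhs => rw [Model.eq_sum a, map_sum]
  refine Finset.sum_congr rfl fun ν _ => ?_
  rw [map_mul, toHom_one_tmul]
  rfl

/-- The constant term of the value of a holomorphic function `u` is `u y`: the function `u - c`
is invertible near `y` if `c ≠ u y`, and so the constant term cannot be `c`. -/
theorem repr_onHol_empty {V : Opens M} (hy : y ∈ V) (hV : V ≤ W) (u : Hol m V) :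
    (Ext.monomial n).repr (χ.onHol hy hV u) ∅ = u.1 ⟨y, hy⟩ := by
  set c := (Ext.monomial n).repr (χ.onHol hy hV u) ∅ with hc
  by_contra hne
  let V' : Opens M := ⟨Subtype.val '' {x : V | u.1 x ≠ c},
    V.isOpen.isOpenMap_subtype_val _ (isOpen_ne_fun (Hol.continuous u) continuous_const)⟩
  have hV' : V' ≤ V := by
    rintro _ ⟨x, _, rfl⟩
    exact x.2
  have hy' : y ∈ V' := ⟨⟨y, hy⟩, fun h => hne h.symm, rfl⟩
  have hunit : IsUnit (Hol.res hV' (u - algebraMap ℂ _ c)) := by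
    refine Hol.isUnit_of_forall_ne_zero _ ?_
    rintro ⟨_, x, hx, rfl⟩
    exact sub_ne_zero.2 hx
  have h := Ext.repr_empty_ne_zero_of_isUnit (hunit.map (χ.onHol hy' (hV'.trans hV)))
  rw [onHol_res χ hy' hV' hV, map_sub, AlgHom.commutes, map_sub, Finsupp.sub_apply, ← hc,
    Algebra.algebraMap_eq_smul_one, map_smul, Finsupp.smul_apply, Ext.repr_one] at h
  simp at h

theorem onHol_sub_mem_degreeGE {V : Opens M} (hy : y ∈ V) (hV : V ≤ W) (u : Hol m V) :
    χ.onHol hy hV u - algebraMap ℂ _ (u.1 ⟨y, hy⟩) ∈ Ext.degreeGE n 1 := by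
  have := Ext.sub_algebraMap_mem_degreeGE (χ.onHol hy hV u)
  rwa [repr_onHol_empty] at this

/-- The leading coefficients of the value of a section without terms of degree less than `k`. -/
theorem repr_toHom_of_card {V : Opens M} (hy : y ∈ V) (hV : V ≤ W) (a : Model m n V) {k : ℕ}
    (ha : ∀ μ : Finset (Fin n), μ.card < k → (Model.basis m n V).repr a μ = 0)
    {ν : Finset (Fin n)} (hν : ν.card = k) :
    (Ext.monomial n).repr (χ.toHom V hy hV a) ν = ∑ μ with μ.card = k,
      ((Model.basis m n V).repr a μ).1 ⟨y, hy⟩ *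
        (Ext.monomial n).repr (χ.onExt (hV hy) (Ext.monomial n μ)) ν := by
  rw [toHom_eq_sum, map_sum, Finsupp.finsetSum_apply, Finset.sum_filter]
  refine Finset.sum_congr rfl fun μ _ => ?_
  set f := (Model.basis m n V).repr a μ with hf
  have hθ := Ext.algHom_monomial_mem_degreeGE (χ.onExt (hV hy)) μ
  split_ifs with hμ
  · have h1 := Ext.mul_mem_degreeGE (χ.onHol_sub_mem_degreeGE hy hV f) hθ ν (by omega)
    rw [sub_mul, map_sub, Finsupp.sub_apply, sub_eq_zero, ← Algebra.smul_def, map_smul,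
      Finsupp.smul_apply, smul_eq_mul] at h1
    exact h1
  · rcases lt_or_gt_of_ne hμ with h | h
    · rw [hf, ha μ h]; simp
    · exact Ext.mul_mem_degreeGE (k := 0) (Ext.mem_degreeGE_zero _) hθ ν (by omega)

end ExtPoint

variable [IsManifold 𝓘(ℂ, EuclideanSpace ℂ (Fin m)) 1 M]

/-- The value of a holomorphic function `u` at a point with values in `⋀ ℂⁿ`, multiplied by an
element of degree at least `n + 1 - k`, is bounded in terms of the supremum of `u`. Hadamard's
lemma reduces this to the products with the nilpotent parts of the coordinates, of degree at least
`n + 1 - (k - 1)`. -/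
theorem ExtPoint.exists_coeffNorm_mul_onHol_le (W : Opens M) (y₀ : M) (B : ℝ) (k : ℕ) :
    ∀ ρ : ℝ, 0 < ρ → ∃ C : ℝ, 0 ≤ C ∧ ∀ (y : M) (hy : y ∈ coordDomain m y₀)
      (_ : ball (coordChart (m := m) y₀ y) ρ ⊆ (coordChart (m := m) y₀).target)
      (hW : polydisc m y₀ y ρ ≤ W) (hyW : y ∈ W ⊓ coordDomain m y₀) (hρ : 0 < ρ)
      (χ : ExtPoint m n W y)
      (_ : ∀ i, Ext.coeffNorm (χ.onHol hyW inf_le_left (Hol.coord y₀ inf_le_right i)) ≤ B)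
      (u : Hol m (polydisc m y₀ y ρ)) (ε : ℝ) (_ : ∀ x, ‖u.1 x‖ ≤ ε),
      ∀ t ∈ Ext.degreeGE n (n + 1 - k),
        Ext.coeffNorm (t * χ.onHol (mem_polydisc_self hy hρ) hW u) ≤ C * ε * Ext.coeffNorm t := by
  obtain ⟨D, hD0, hD⟩ := Ext.exists_coeffNorm_mul_le n
  induction k with
  | zero =>
    refine fun ρ _ => ⟨0, le_rfl, fun y hy _ hW _ hρ χ _ u ε hε t ht => ?_⟩
    rw [Ext.eq_zero_of_mem_degreeGE (by omega) ht]
    simp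
  | succ k ih =>
    intro ρ hρ
    obtain ⟨C, hC0, hC⟩ := ih (ρ / 2) (half_pos hρ)
    refine ⟨1 + m * (C * (4 / ρ) * (D * (2 * |B|))), by positivity,
      fun y hy hball hW hyW _ χ hB u ε hε t ht => ?_⟩
    have hε0 : 0 ≤ ε := (norm_nonneg _).trans (hε ⟨y, mem_polydisc_self hy hρ⟩)
    obtain ⟨q, hq, hu⟩ := Hol.exists_hadamard_quotients hy hρ hball u hε
    have hle : polydisc m y₀ y (ρ / 2) ≤ polydisc m y₀ y ρ := polydisc_mono (by linarith)
    have hyρ := mem_polydisc_self hy (half_pos hρ)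
    -- the nilpotent parts of the coordinates
    let d : Fin m → Ext n := fun i => χ.onHol hyW inf_le_left (Hol.coord y₀ inf_le_right i) -
      algebraMap ℂ _ (coordChart (m := m) y₀ y i)
    have hd1 : ∀ i, d i ∈ Ext.degreeGE n 1 := fun i => χ.onHol_sub_mem_degreeGE hyW inf_le_left _
    have hdB : ∀ i, Ext.coeffNorm (d i) ≤ 2 * |B| := by
      intro i
      have h1 := Ext.norm_repr_le (χ.onHol hyW inf_le_left (Hol.coord y₀ inf_le_right i)) ∅
      rw [χ.repr_onHol_empty] at h1
      have h2 : ‖coordChart (m := m) y₀ y i‖ ≤ B := h1.trans (hB i)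
      refine (Ext.coeffNorm_sub_le _ _).trans ?_
      rw [Algebra.algebraMap_eq_smul_one, Ext.coeffNorm_smul, Ext.coeffNorm_one]
      linarith [hB i, le_abs_self B]
    have hcoord : ∀ i, χ.onHol hyρ (hle.trans hW)
        (Hol.coord y₀ polydisc_le_coordDomain i -
          algebraMap ℂ _ (coordChart (m := m) y₀ y i)) = d i := by
      intro i
      have h := χ.onHol_res hyρ (le_inf (hle.trans hW) polydisc_le_coordDomain) inf_le_left
        (Hol.coord y₀ inf_le_right i)
      rw [map_sub, AlgHom.commutes]
      exact congrArg (· - _) h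
    have hval : t * χ.onHol (mem_polydisc_self hy hρ) hW u =
        u.1 ⟨y, mem_polydisc_self hy hρ⟩ • t +
          ∑ i, (t * d i) * χ.onHol hyρ (hle.trans hW) (q i) := by
      rw [← χ.onHol_res hyρ hle hW u, hu, map_add, AlgHom.commutes, map_sum, mul_add,
        Finset.mul_sum, ← Algebra.commutes, ← Algebra.smul_def]
      refine congrArg _ (Finset.sum_congr rfl fun i _ => ?_)
      rw [map_mul, hcoord, mul_assoc]
    have hterm : ∀ i, Ext.coeffNorm ((t * d i) * χ.onHol hyρ (hle.trans hW) (q i)) ≤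
        C * (4 / ρ) * (D * (2 * |B|)) * ε * Ext.coeffNorm t := by
      intro i
      have hmem : t * d i ∈ Ext.degreeGE n (n + 1 - k) :=
        Ext.degreeGE_anti (by omega) (Ext.mul_mem_degreeGE ht (hd1 i))
      have h1 := hC y hy ((ball_subset_ball (by linarith)).trans hball) (hle.trans hW) hyW
        (half_pos hρ) χ hB (q i) _ (hq i) _ hmem
      refine h1.trans ?_
      have h2 : Ext.coeffNorm (t * d i) ≤ D * Ext.coeffNorm t * (2 * |B|) :=
        (hD _ _).trans (mul_le_mul_of_nonneg_left (hdB i)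
          (mul_nonneg hD0 (Ext.coeffNorm_nonneg t)))
      calc C * (4 / ρ * ε) * Ext.coeffNorm (t * d i)
          ≤ C * (4 / ρ * ε) * (D * Ext.coeffNorm t * (2 * |B|)) :=
            mul_le_mul_of_nonneg_left h2 (by positivity)
        _ = _ := by ring
    rw [hval]
    refine (Ext.coeffNorm_add_le _ _).trans ?_
    rw [Ext.coeffNorm_smul]
    have h3 := (Ext.coeffNorm_sum_le Finset.univ
      fun i => (t * d i) * χ.onHol hyρ (hle.trans hW) (q i)).trans
      (Finset.sum_le_sum fun i _ => hterm i)
    rw [Finset.sum_const, Finset.card_univ, Fintype.card_fin, nsmul_eq_mul] at h3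
    have h4 := mul_le_mul_of_nonneg_right (hε ⟨y, mem_polydisc_self hy hρ⟩)
      (Ext.coeffNorm_nonneg t)
    calc _ ≤ _ := add_le_add h4 h3
      _ = _ := by ring

/-- Points with values in `⋀ ℂⁿ` are uniformly bounded with respect to the supremum of the
coefficients of a section, as long as the values of the coordinates stay bounded. -/
theorem ExtPoint.exists_coeffNorm_toHom_le {W V : Opens M} (hV : V ≤ W) {y₀ : M} (hy₀ : y₀ ∈ V)
    (B : ℝ) : ∃ C : ℝ, 0 ≤ C ∧ ∀ᶠ y in 𝓝 y₀, ∀ (hy : y ∈ V) (hyW : y ∈ W ⊓ coordDomain m y₀)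
      (χ : ExtPoint m n W y),
      (∀ i, Ext.coeffNorm (χ.onHol hyW inf_le_left (Hol.coord y₀ inf_le_right i)) ≤ B) →
      (∀ ν, Ext.coeffNorm (χ.onExt (hV hy) (Ext.monomial n ν)) ≤ B) →
      ∀ (a : Model m n V) (ε : ℝ), (∀ ν x, ‖((Model.basis m n V).repr a ν).1 x‖ ≤ ε) →
        Ext.coeffNorm (χ.toHom V hy hV a) ≤ C * ε := by
  obtain ⟨D, hD0, hD⟩ := Ext.exists_coeffNorm_mul_le n
  let z := coordChart (m := m) y₀
  have hopen : IsOpen (z.target ∩ z.symm ⁻¹' (V : Set M)) :=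
    z.symm.isOpen_inter_preimage V.isOpen
  have hmem : z y₀ ∈ z.target ∩ z.symm ⁻¹' (V : Set M) := by
    refine ⟨z.map_source (mem_coordChart_source y₀), ?_⟩
    rw [Set.mem_preimage, z.left_inv (mem_coordChart_source y₀)]
    exact hy₀
  -- polydiscs of radius `r / 2` with centre near `y₀` lie in `V`
  obtain ⟨r, hr, hball⟩ := Metric.isOpen_iff.1 hopen _ hmem
  obtain ⟨C, hC0, hC⟩ := ExtPoint.exists_coeffNorm_mul_onHol_le (m := m) (n := n) W y₀ B (n + 1)
    (r / 2) (half_pos hr)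
  refine ⟨Fintype.card (Finset (Fin n)) * (D * C * |B|), by positivity, ?_⟩
  have hnear : ∀ᶠ y in 𝓝 y₀, y ∈ polydisc m y₀ y₀ (r / 2) :=
    (polydisc m y₀ y₀ (r / 2)).isOpen.mem_nhds
      (mem_polydisc_self (mem_coordChart_source y₀) (half_pos hr))
  filter_upwards [hnear] with y hyr hy hyW χ hB1 hB2 a ε hε
  have hsub : ball (z y) (r / 2) ⊆ ball (z y₀) r := ball_subset_ball' (by
    have h := hyr.2
    rw [Set.mem_preimage, mem_ball] at h
    change dist (z y) (z y₀) < r / 2 at h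
    linarith)
  have hpV : polydisc m y₀ y (r / 2) ≤ V := by
    intro x hx
    have h := (hball (hsub hx.2)).2
    rw [Set.mem_preimage, z.left_inv hx.1] at h
    exact h
  have hε0 : 0 ≤ ε := (norm_nonneg _).trans (hε ∅ ⟨y, hy⟩)
  have hhol : ∀ u : Hol m V, (∀ x, ‖u.1 x‖ ≤ ε) → Ext.coeffNorm (χ.onHol hy hV u) ≤ C * ε := by
    intro u hu
    have h := hC y hyW.2 (fun p hp => (hball (hsub hp)).1) (hpV.trans hV) hyW (half_pos hr) χ hB1
      (Hol.res hpV u) ε (fun x => hu _) 1 (by simpa using Ext.mem_degreeGE_zero (1 : Ext n))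
    rwa [one_mul, Ext.coeffNorm_one, mul_one, χ.onHol_res] at h
  rw [χ.toHom_eq_sum]
  refine (Ext.coeffNorm_sum_le _ _).trans ?_
  calc _ ≤ ∑ _ν : Finset (Fin n), D * (C * ε) * |B| := Finset.sum_le_sum fun ν _ =>
        (hD _ _).trans (mul_le_mul (mul_le_mul_of_nonneg_left (hhol _ (hε ν)) hD0)
          ((hB2 ν).trans (le_abs_self B)) (Ext.coeffNorm_nonneg _) (by positivity))
    _ = _ := by
      rw [Finset.sum_const, Finset.card_univ, nsmul_eq_mul]
      ring

end Points

/-! ### Values of sections of the structure sheaf -/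

section Values

variable {m n : ℕ} {M : Type u} [TopologicalSpace M] [ChartedSpace (EuclideanSpace ℂ (Fin m)) M]
  {A : SuperalgebraSheaf M}

theorem SuperalgebraSheaf.res_res {U V V' : Opens M} (h : V ≤ U) (h' : V' ≤ V)
    (f : A.Sections U) : A.res h' (A.res h f) = A.res (h'.trans h) f := by
  have : A.sheaf.presheaf.map (homOfLE (h'.trans h)).op =
      A.sheaf.presheaf.map (homOfLE h).op ≫ A.sheaf.presheaf.map (homOfLE h').op := by
    rw [← Functor.map_comp]
    rfl
  simp only [SuperalgebraSheaf.res, this]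
  rfl

namespace LocalTrivialization

variable {W : Opens M} (θ : LocalTrivialization m n A W)

theorem equiv_symm_res {V V' : Opens M} (hV : V ≤ W) (h : V' ≤ V) (f : A.Sections V) :
    (θ.equiv V' (h.trans hV)).symm (A.res h f) = Model.res h ((θ.equiv V hV).symm f) := by
  rw [AlgEquiv.symm_apply_eq, θ.equiv_res hV, AlgEquiv.apply_symm_apply]

/-- The value of a section at a point `x`: its coefficients with respect to the odd coordinates are
evaluated at `x`. -/
def eval {V : Opens M} (x : M) (hW : x ∈ W) (hV : x ∈ V) : A.Sections V →ₐ[ℂ] Ext n :=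
  (Model.eval (V := W ⊓ V) x (Opens.mem_inf.2 ⟨hW, hV⟩)).comp
    ((θ.equiv (W ⊓ V) inf_le_left).symm.toAlgHom.comp (A.res inf_le_right))

theorem eval_apply {V : Opens M} {x : M} (hW : x ∈ W) (hV : x ∈ V) (f : A.Sections V) :
    θ.eval x hW hV f = Model.eval (V := W ⊓ V) x (Opens.mem_inf.2 ⟨hW, hV⟩)
      ((θ.equiv (W ⊓ V) inf_le_left).symm (A.res inf_le_right f)) := rfl

theorem eval_res {V V' : Opens M} (h : V' ≤ V) {x : M} (hW : x ∈ W) (hV : x ∈ V')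
    (f : A.Sections V) : θ.eval x hW hV (A.res h f) = θ.eval x hW (h hV) f := by
  rw [eval_apply, eval_apply, A.res_res, ← A.res_res inf_le_right (inf_le_inf_left W h),
    θ.equiv_symm_res inf_le_left, Model.eval_res]

theorem eval_of_le {V : Opens M} (h : V ≤ W) {x : M} (hV : x ∈ V) (f : A.Sections V) :
    θ.eval x (h hV) hV f = Model.eval x hV ((θ.equiv V h).symm f) := by
  rw [eval_apply, θ.equiv_symm_res h inf_le_right, Model.eval_res]

theorem eval_equiv {V : Opens M} (h : V ≤ W) {x : M} (hV : x ∈ V) (a : Model m n V) :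
    θ.eval x (h hV) hV (θ.equiv V h a) = Model.eval x hV a := by
  rw [θ.eval_of_le h, AlgEquiv.symm_apply_apply]

/-- A morphism and a point `x` yield a point with values in `⋀ ℂⁿ` over the image of `x`: sections
are pulled back, and then evaluated at `x`. -/
def extPoint {W' : Opens M} (η : LocalTrivialization m n A W') (ψ : SuperalgebraSheaf.Hom A A)
    (x : M) (hW : x ∈ W) : ExtPoint m n W' (ψ.base x) where
  toHom V hy hV := (θ.eval (V := Opens.comap ψ.base V) x hW hy).comp
    ((ψ.pullback V).comp (η.equiv V hV).toAlgHom)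
  toHom_res {U V} hy h hU a := by
    change θ.eval (V := Opens.comap ψ.base V) x hW hy
      (ψ.pullback V (η.equiv V (h.trans hU) (Model.res h a))) =
      θ.eval (V := Opens.comap ψ.base U) x hW (h hy) (ψ.pullback U (η.equiv U hU a))
    rw [η.equiv_res hU, ψ.pullback_res]
    exact θ.eval_res _ hW _ _

theorem extPoint_toHom {W' : Opens M} (η : LocalTrivialization m n A W')
    (ψ : SuperalgebraSheaf.Hom A A) {x : M} (hW : x ∈ W) {V : Opens M} (hy : ψ.base x ∈ V)
    (hV : V ≤ W') (a : Model m n V) : (θ.extPoint η ψ x hW).toHom V hy hV a =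
      θ.eval (V := Opens.comap ψ.base V) x hW hy (ψ.pullback V (η.equiv V hV a)) := rfl

end LocalTrivialization

end Values

/-! ### The topology in terms of values of sections -/

namespace ComplexSupermanifold

open Filter Topology

variable {m n : ℕ} {M : Type u} [TopologicalSpace M] [ChartedSpace (EuclideanSpace ℂ (Fin m)) M]
  {𝓜 : ComplexSupermanifold m n M}

/-- The value at `x` of the pullback of a section under an automorphism. -/
def value (φ : 𝓜.Aut) {U W : Opens M} (θ : LocalTrivialization m n 𝓜.toSuperalgebraSheaf W)
    (f : 𝓜.Sections U) (x : M) (hW : x ∈ W) (hU : φ.hom.base x ∈ U) : Ext n :=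
  θ.eval (V := Opens.comap φ.hom.base U) x hW hU (φ.hom.pullback U f)

theorem mem_subbasicSet_iff {K : Set M} {U W : Opens M} {f : 𝓜.Sections U}
    {θ : LocalTrivialization m n 𝓜.toSuperalgebraSheaf W} {G : Finset (Fin n) → Set ℂ} {φ : 𝓜.Aut} :
    φ ∈ 𝓜.subbasicSet K U f θ G ↔
      ∀ x ∈ K, φ.hom.base x ∈ U ∧ ∀ (hW : x ∈ W) (hU : φ.hom.base x ∈ U) (ν : Finset (Fin n)),
        (Ext.monomial n).repr (value φ θ f x hW hU) ν ∈ G ν := by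
  have key : ∀ x (hW : x ∈ W) (hU : φ.hom.base x ∈ U) (ν : Finset (Fin n)),
      (Ext.monomial n).repr (value φ θ f x hW hU) ν =
      (θ.coeff (V := W ⊓ Opens.comap φ.hom.base U) inf_le_left
        (𝓜.res inf_le_right (φ.hom.pullback U f)) ν).1 ⟨x, hW, hU⟩ := fun x hW hU ν =>
    Model.repr_eval _ _ _
  constructor
  · rintro ⟨h1, h2⟩ x hx
    refine ⟨h1 hx, fun hW hU ν => ?_⟩
    rw [key]
    exact h2 ν ⟨x, hW, hU⟩ hx
  · intro h
    refine ⟨fun x hx => (h x hx).1, fun ν x hx => ?_⟩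
    have := (h x hx).2 x.2.1 x.2.2 ν
    exact Eq.mp (congrArg (· ∈ G ν) (key x x.2.1 x.2.2 ν)) this

theorem isOpen_subbasicSet {K : Set M} {U W : Opens M} (f : 𝓜.Sections U)
    (θ : LocalTrivialization m n 𝓜.toSuperalgebraSheaf W) {G : Finset (Fin n) → Set ℂ}
    (hK : IsCompact K) (hKW : K ⊆ W) (hG : ∀ ν, IsOpen (G ν)) :
    IsOpen (𝓜.subbasicSet K U f θ G) :=
  isOpen_generateFrom_of_mem ⟨K, U, W, f, θ, G, hK, hKW, hG, rfl⟩

/-- The sets `Δ(K, U, f, θ_j, G_ν)` with `K` a compact neighbourhood of `x₀` make the coefficients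
of `(φ^* f)(x)` jointly continuous in `φ` and `x`. -/
theorem eventually_repr_value_mem [LocallyCompactSpace M] (φ₀ : 𝓜.Aut) {x₀ : M}
    {U W : Opens M} (θ : LocalTrivialization m n 𝓜.toSuperalgebraSheaf W) (f : 𝓜.Sections U)
    (hW : x₀ ∈ W) (hU : φ₀.hom.base x₀ ∈ U) {G : Finset (Fin n) → Set ℂ} (hG : ∀ ν, IsOpen (G ν))
    (h₀ : ∀ ν, (Ext.monomial n).repr (value φ₀ θ f x₀ hW hU) ν ∈ G ν) :
    ∀ᶠ p in 𝓝 (φ₀, x₀), p.1.hom.base p.2 ∈ U ∧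
      ∀ (hW : p.2 ∈ W) (hU : p.1.hom.base p.2 ∈ U) (ν : Finset (Fin n)),
        (Ext.monomial n).repr (value p.1 θ f p.2 hW hU) ν ∈ G ν := by
  let V : Opens M := W ⊓ Opens.comap φ₀.hom.base U
  let c : Finset (Fin n) → Hol m V := fun ν => θ.coeff (V := V) inf_le_left
    (𝓜.res inf_le_right (φ₀.hom.pullback U f)) ν
  have hc : ∀ ν (x : V), (Ext.monomial n).repr (value φ₀ θ f x x.2.1 x.2.2) ν = (c ν).1 x :=
    fun ν x => Model.repr_eval _ _ _
  let S : Set V := ⋂ ν, (c ν).1 ⁻¹' G ν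
  have hS : IsOpen S := isOpen_iInter_of_finite fun ν => (hG ν).preimage (Hol.continuous (c ν))
  have hS' : IsOpen (Subtype.val '' S) := V.isOpen.isOpenMap_subtype_val _ hS
  have hx₀ : x₀ ∈ Subtype.val '' S := ⟨⟨x₀, hW, hU⟩, Set.mem_iInter.2 fun ν => by
    have := h₀ ν
    rwa [hc ν ⟨x₀, hW, hU⟩] at this, rfl⟩
  obtain ⟨K, hK, hxK, hKS⟩ := exists_compact_subset hS' hx₀
  have hKW : K ⊆ W := fun x hx => by
    obtain ⟨y, _, rfl⟩ := hKS hx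
    exact y.2.1
  have hmem : φ₀ ∈ 𝓜.subbasicSet K U f θ G := by
    rw [mem_subbasicSet_iff]
    intro x hx
    obtain ⟨y, hy, rfl⟩ := hKS hx
    refine ⟨y.2.2, fun _ _ ν => ?_⟩
    rw [hc ν y]
    exact Set.mem_iInter.1 hy ν
  filter_upwards [prod_mem_nhds ((isOpen_subbasicSet f θ hK hKW hG).mem_nhds hmem)
    (mem_interior_iff_mem_nhds.1 hxK)] with p hp
  exact mem_subbasicSet_iff.1 hp.1 p.2 hp.2

/-- Evaluation `(φ, x) ↦ φ x` is continuous. -/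
theorem tendsto_base [LocallyCompactSpace M] (φ₀ : 𝓜.Aut) (x₀ : M) :
    Tendsto (fun p : 𝓜.Aut × M => p.1.hom.base p.2) (𝓝 (φ₀, x₀)) (𝓝 (φ₀.hom.base x₀)) := by
  obtain ⟨W, hW, ⟨θ⟩⟩ := 𝓜.locally_trivial x₀
  refine (nhds_basis_opens _).tendsto_right_iff.2 fun s hs => ?_
  have := eventually_repr_value_mem φ₀ (U := ⟨s, hs.2⟩) θ 0 hW hs.1 (G := fun _ => Set.univ)
    (fun _ => isOpen_univ) (fun _ => Set.mem_univ _)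
  exact this.mono fun p hp => hp.1

/-- The values `(φ, x) ↦ (φ^* f)(x)` are jointly continuous. -/
theorem eventually_coeffNorm_value_sub_lt [LocallyCompactSpace M] (φ₀ : 𝓜.Aut) {x₀ : M}
    {U W : Opens M} (θ : LocalTrivialization m n 𝓜.toSuperalgebraSheaf W) (f : 𝓜.Sections U)
    (hW : x₀ ∈ W) (hU : φ₀.hom.base x₀ ∈ U) {ε : ℝ} (hε : 0 < ε) :
    ∀ᶠ p in 𝓝 (φ₀, x₀), ∀ (hW' : p.2 ∈ W) (hU' : p.1.hom.base p.2 ∈ U),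
      Ext.coeffNorm (value p.1 θ f p.2 hW' hU' - value φ₀ θ f x₀ hW hU) < ε := by
  set δ : ℝ := ε / Fintype.card (Finset (Fin n)) with hδ
  have hcard : (0 : ℝ) < Fintype.card (Finset (Fin n)) := by positivity
  have hδ0 : 0 < δ := by positivity
  filter_upwards [eventually_repr_value_mem φ₀ θ f hW hU
    (G := fun ν => Metric.ball ((Ext.monomial n).repr (value φ₀ θ f x₀ hW hU) ν) δ)
    (fun _ => Metric.isOpen_ball) (fun _ => Metric.mem_ball_self hδ0)] with p hp hW' hU'
  have h : ∀ ν ∈ (Finset.univ : Finset (Finset (Fin n))), ‖(Ext.monomial n).repr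
      (value p.1 θ f p.2 hW' hU' - value φ₀ θ f x₀ hW hU) ν‖ < δ := by
    intro ν _
    have := hp.2 hW' hU' ν
    rwa [mem_ball_iff_norm, ← Finsupp.sub_apply, ← map_sub] at this
  refine (Finset.sum_lt_sum_of_nonempty Finset.univ_nonempty h).trans_eq ?_
  rw [Finset.sum_const, Finset.card_univ, nsmul_eq_mul, hδ]
  field_simp

/-- A map to the automorphism group is continuous if all values of pullbacks of sections are jointly
continuous in the parameter and the point. Compactness of the sets `K` in the definition of the
topology turns this into uniformity on `K`. -/
theorem continuousAt_of_value {X : Type*} [TopologicalSpace X] {F : X → 𝓜.Aut} {a : X}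
    (hbase : ∀ x₀, Tendsto (fun p : X × M => (F p.1).hom.base p.2) (𝓝 (a, x₀))
      (𝓝 ((F a).hom.base x₀)))
    (hval : ∀ (x₀ : M) (U W : Opens M) (θ : LocalTrivialization m n 𝓜.toSuperalgebraSheaf W)
      (f : 𝓜.Sections U) (hW : x₀ ∈ W) (hU : (F a).hom.base x₀ ∈ U) (ε : ℝ), 0 < ε →
      ∀ᶠ p in 𝓝 (a, x₀), ∀ (hW' : p.2 ∈ W) (hU' : (F p.1).hom.base p.2 ∈ U),
        Ext.coeffNorm (value (F p.1) θ f p.2 hW' hU' - value (F a) θ f x₀ hW hU) < ε) :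
    ContinuousAt F a := by
  refine TopologicalSpace.tendsto_nhds_generateFrom_iff.2 ?_
  rintro _ ⟨K, U, W, f, θ, G, hK, hKW, hG, rfl⟩ ha
  rw [mem_subbasicSet_iff] at ha
  have := hK.eventually_forall_of_forall_eventually (x₀ := a) (P := fun t x =>
    (F t).hom.base x ∈ U ∧ ∀ (hW : x ∈ W) (hU : (F t).hom.base x ∈ U) (ν : Finset (Fin n)),
        (Ext.monomial n).repr (value (F t) θ f x hW hU) ν ∈ G ν) ?_
  · exact this.mono fun t ht => mem_subbasicSet_iff.2 ht
  · intro x hx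
    obtain ⟨hU, hxG⟩ := ha x hx
    have hW := hKW hx
    have hex : ∀ ν, ∃ δ > 0, Metric.ball ((Ext.monomial n).repr (value (F a) θ f x hW hU) ν) δ ⊆
        G ν := fun ν => Metric.isOpen_iff.1 (hG ν) _ (hxG hW hU ν)
    choose δ hδ hball using hex
    have hall : ∀ᶠ p in 𝓝 (a, x), ∀ ν, ∀ (hW' : p.2 ∈ W) (hU' : (F p.1).hom.base p.2 ∈ U),
        Ext.coeffNorm (value (F p.1) θ f p.2 hW' hU' - value (F a) θ f x hW hU) < δ ν :=
      eventually_all.2 fun ν => hval x U W θ f hW hU (δ ν) (hδ ν)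
    filter_upwards [hall, (hbase x).eventually (U.isOpen.mem_nhds hU)] with p hp hpU
    refine ⟨hpU, fun hW' hU' ν => hball ν ?_⟩
    rw [mem_ball_iff_norm, ← Finsupp.sub_apply, ← map_sub]
    exact (Ext.norm_repr_le _ ν).trans_lt (hp ν hW' hU')

/-- The values `(φ^* f)(x)` depend continuously on `φ`, uniformly for `x` in a compact set. -/
theorem eventually_forall_coeffNorm_value_sub_lt [LocallyCompactSpace M] (φ₀ : 𝓜.Aut)
    {K : Set M} (hK : IsCompact K) {U W : Opens M}
    (θ : LocalTrivialization m n 𝓜.toSuperalgebraSheaf W) (f : 𝓜.Sections U) (hW : K ⊆ W)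
    (hU : ∀ x ∈ K, φ₀.hom.base x ∈ U) {ε : ℝ} (hε : 0 < ε) :
    ∀ᶠ φ in 𝓝 φ₀, ∀ x ∈ K, φ.hom.base x ∈ U ∧
      ∀ (hW : x ∈ W) (hU : φ.hom.base x ∈ U) (hU₀ : φ₀.hom.base x ∈ U),
        Ext.coeffNorm (value φ θ f x hW hU - value φ₀ θ f x hW hU₀) < ε := by
  refine hK.eventually_forall_of_forall_eventually fun x hx => ?_
  have h1 := eventually_coeffNorm_value_sub_lt φ₀ θ f (hW hx) (hU x hx) (half_pos hε)
  have h2 : Tendsto (fun p : 𝓜.Aut × M => (φ₀, p.2)) (𝓝 (φ₀, x)) (𝓝 (φ₀, x)) :=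
    (continuous_const.prodMk continuous_snd).tendsto' _ _ rfl
  filter_upwards [h1, h2.eventually h1,
    (tendsto_base φ₀ x).eventually (U.isOpen.mem_nhds (hU x hx))] with p hp hp' hpU
  exact ⟨hpU, fun hW hU hU₀ => Ext.coeffNorm_sub_lt (hp hW hU) (hp' hW hU₀)⟩

/-! ### The main estimate -/

theorem value_sub (φ : 𝓜.Aut) {U W : Opens M}
    (θ : LocalTrivialization m n 𝓜.toSuperalgebraSheaf W) (f g : 𝓜.Sections U) {x : M} (hW : x ∈ W)
    (hU : φ.hom.base x ∈ U) :
    value φ θ (f - g) x hW hU = value φ θ f x hW hU - value φ θ g x hW hU := by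
  rw [value, map_sub, map_sub]; rfl

theorem value_res (φ : 𝓜.Aut) {U V W : Opens M}
    (θ : LocalTrivialization m n 𝓜.toSuperalgebraSheaf W) (h : V ≤ U) (f : 𝓜.Sections U) {x : M}
    (hW : x ∈ W) (hV : φ.hom.base x ∈ V) :
    value φ θ (𝓜.res h f) x hW hV = value φ θ f x hW (h hV) := by
  rw [value, φ.hom.pullback_res]
  exact θ.eval_res _ hW _ _

theorem value_one {U W : Opens M} (θ : LocalTrivialization m n 𝓜.toSuperalgebraSheaf W)
    (f : 𝓜.Sections U) {x : M} (hW : x ∈ W) (hU : x ∈ U) :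
    value (1 : 𝓜.Aut) θ f x hW hU = θ.eval x hW hU f := rfl

theorem value_mul (φ ψ : 𝓜.Aut) {U W : Opens M}
    (θ : LocalTrivialization m n 𝓜.toSuperalgebraSheaf W) (f : 𝓜.Sections U) {x : M} (hW : x ∈ W)
    (hU : φ.hom.base (ψ.hom.base x) ∈ U) : value (φ * ψ) θ f x hW hU =
      value ψ θ (U := Opens.comap φ.hom.base U) (φ.hom.pullback U f) x hW hU := rfl

theorem value_congr {φ ψ : 𝓜.Aut} (h : φ = ψ) {U W : Opens M}
    (θ : LocalTrivialization m n 𝓜.toSuperalgebraSheaf W) (f : 𝓜.Sections U) {x : M} (hW : x ∈ W)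
    (hφ : φ.hom.base x ∈ U) (hψ : ψ.hom.base x ∈ U) :
    value φ θ f x hW hφ = value ψ θ f x hW hψ := by
  subst h; rfl

/-- A bound for the expansion of a section gives a bound for the values of its pullbacks, uniformly
in a neighbourhood of an automorphism and a point. -/
theorem exists_coeffNorm_value_le [LocallyCompactSpace M]
    [IsManifold 𝓘(ℂ, EuclideanSpace ℂ (Fin m)) 1 M] (ψ₀ : 𝓜.Aut) {x₀ : M} {W W' V : Opens M}
    (θ : LocalTrivialization m n 𝓜.toSuperalgebraSheaf W) (hW₀ : x₀ ∈ W)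
    (η : LocalTrivialization m n 𝓜.toSuperalgebraSheaf W') (hV : V ≤ W')
    (hV₀ : ψ₀.hom.base x₀ ∈ V) :
    ∃ C : ℝ, 0 ≤ C ∧ ∀ᶠ p in 𝓝 (ψ₀, x₀), ∀ (hW : p.2 ∈ W) (hpV : p.1.hom.base p.2 ∈ V)
      (h : 𝓜.Sections V) (ε : ℝ),
      (∀ y (hy : y ∈ V), Ext.coeffNorm (η.eval y (hV hy) hy h) ≤ ε) →
        Ext.coeffNorm (value p.1 θ h p.2 hW hpV) ≤ C * ε := by
  set y₀ := ψ₀.hom.base x₀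
  have hy₀ : y₀ ∈ W' ⊓ coordDomain m y₀ :=
    Opens.mem_inf.2 ⟨hV hV₀, mem_coordChart_source (m := m) y₀⟩
  -- the even and the odd coordinates near `y₀`
  let z : Fin m → 𝓜.Sections (W' ⊓ coordDomain m y₀) := fun i =>
    η.equiv _ inf_le_left (Hol.coord y₀ inf_le_right i ⊗ₜ 1)
  let t : Finset (Fin n) → 𝓜.Sections W' := fun ν => η.equiv W' le_rfl (1 ⊗ₜ Ext.monomial n ν)
  set B : ℝ := ∑ i, Ext.coeffNorm (value ψ₀ θ (z i) x₀ hW₀ hy₀) +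
    ∑ ν, Ext.coeffNorm (value ψ₀ θ (t ν) x₀ hW₀ (hV hV₀)) + 1 with hB
  have hclose : ∀ {a b : Ext n}, Ext.coeffNorm (a - b) < 1 →
      Ext.coeffNorm a ≤ Ext.coeffNorm b + 1 := by
    intro a b h
    have := Ext.coeffNorm_add_le (a - b) b
    rw [sub_add_cancel] at this
    linarith
  have hBz : ∀ i, Ext.coeffNorm (value ψ₀ θ (z i) x₀ hW₀ hy₀) + 1 ≤ B := by
    intro i
    have h1 := Finset.single_le_sum (f := fun i => Ext.coeffNorm (value ψ₀ θ (z i) x₀ hW₀ hy₀))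
      (fun _ _ => Ext.coeffNorm_nonneg _) (Finset.mem_univ i)
    have h2 : 0 ≤ ∑ ν, Ext.coeffNorm (value ψ₀ θ (t ν) x₀ hW₀ (hV hV₀)) :=
      Finset.sum_nonneg fun _ _ => Ext.coeffNorm_nonneg _
    linarith
  have hBt : ∀ ν, Ext.coeffNorm (value ψ₀ θ (t ν) x₀ hW₀ (hV hV₀)) + 1 ≤ B := by
    intro ν
    have h1 := Finset.single_le_sum
      (f := fun ν => Ext.coeffNorm (value ψ₀ θ (t ν) x₀ hW₀ (hV hV₀)))
      (fun _ _ => Ext.coeffNorm_nonneg _) (Finset.mem_univ ν)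
    have h2 : 0 ≤ ∑ i, Ext.coeffNorm (value ψ₀ θ (z i) x₀ hW₀ hy₀) :=
      Finset.sum_nonneg fun _ _ => Ext.coeffNorm_nonneg _
    linarith
  obtain ⟨C, hC0, hC⟩ := ExtPoint.exists_coeffNorm_toHom_le (m := m) (n := n) hV hV₀ B
  refine ⟨C, hC0, ?_⟩
  have hz := eventually_all.2 fun i =>
    eventually_coeffNorm_value_sub_lt ψ₀ θ (z i) hW₀ hy₀ one_pos
  have ht := eventually_all.2 fun ν =>
    eventually_coeffNorm_value_sub_lt ψ₀ θ (t ν) hW₀ (hV hV₀) one_pos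
  filter_upwards [hz, ht, (tendsto_base ψ₀ x₀).eventually hC,
    (tendsto_base ψ₀ x₀).eventually ((W' ⊓ coordDomain m y₀).isOpen.mem_nhds hy₀)]
    with p hpz hpt hpC hpD hW hpV h ε hε
  have key := hpC hpV hpD (θ.extPoint η p.1.hom p.2 hW)
    (fun i => (hclose (hpz i hW hpD)).trans (hBz i))
    (fun ν => (hclose (hpt ν hW (hV hpV))).trans (hBt ν))
    ((η.equiv V hV).symm h) ε ?_
  · rw [LocalTrivialization.extPoint_toHom, AlgEquiv.apply_symm_apply] at key
    exact key
  · intro ν y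
    have h1 := Ext.norm_repr_le (η.eval y (hV y.2) y.2 h) ν
    rw [η.eval_of_le hV y.2, Model.repr_eval] at h1
    have h2 := hε y y.2
    rw [η.eval_of_le hV y.2] at h2
    exact h1.trans h2

/-! ### Multiplication -/

/-- Every point in an open set has a neighbourhood with compact closure in that set. -/
theorem exists_opens_le_compact [LocallyCompactSpace M] {x : M} {U : Opens M} (hx : x ∈ U) :
    ∃ (V : Opens M) (K : Set M), x ∈ V ∧ (V : Set M) ⊆ K ∧ IsCompact K ∧ K ⊆ U := by
  obtain ⟨K, hK, hxK, hKU⟩ := exists_compact_subset U.isOpen hx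
  exact ⟨⟨interior K, isOpen_interior⟩, K, hxK, interior_subset, hK, hKU⟩

theorem continuous_mul [LocallyCompactSpace M] [IsManifold 𝓘(ℂ, EuclideanSpace ℂ (Fin m)) 1 M] :
    Continuous fun q : 𝓜.Aut × 𝓜.Aut => q.1 * q.2 := by
  refine continuous_iff_continuousAt.2 fun ⟨φ₀, ψ₀⟩ => continuousAt_of_value ?_ ?_
  all_goals
    have hψ : ∀ x₀ : M, Tendsto (fun p : (𝓜.Aut × 𝓜.Aut) × M => (p.1.2, p.2))
        (𝓝 ((φ₀, ψ₀), x₀)) (𝓝 (ψ₀, x₀)) := fun x₀ =>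
      ((continuous_snd.comp continuous_fst).prodMk continuous_snd).tendsto' _ _ rfl
    have hφ : ∀ x₀ : M, Tendsto (fun p : (𝓜.Aut × 𝓜.Aut) × M => p.1.1)
        (𝓝 ((φ₀, ψ₀), x₀)) (𝓝 φ₀) := fun x₀ =>
      (continuous_fst.comp continuous_fst).tendsto' _ _ rfl
  · intro x₀
    exact (tendsto_base φ₀ (ψ₀.hom.base x₀)).comp
      ((hφ x₀).prodMk_nhds ((tendsto_base ψ₀ x₀).comp (hψ x₀)))
  · intro x₀ U W θ f hW hU ε hε
    obtain ⟨W', hW', ⟨η⟩⟩ := 𝓜.locally_trivial (ψ₀.hom.base x₀)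
    have hy₀ : ψ₀.hom.base x₀ ∈ W' ⊓ Opens.comap φ₀.hom.base U := Opens.mem_inf.2 ⟨hW', hU⟩
    obtain ⟨V, K, hV₀, hVK, hK, hKU⟩ := exists_opens_le_compact hy₀
    have hVW : V ≤ W' := fun y hy => (hKU (hVK hy)).1
    have hVφ₀ : V ≤ Opens.comap φ₀.hom.base U := fun y hy => (hKU (hVK hy)).2
    obtain ⟨C, hC0, hC⟩ := exists_coeffNorm_value_le ψ₀ θ hW η hVW hV₀
    have hδ : 0 < ε / (2 * (C + 1)) := by positivity
    have h1 := eventually_forall_coeffNorm_value_sub_lt φ₀ hK η f (fun y hy => (hKU hy).1)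
      (fun y hy => (hKU hy).2) hδ
    have h2 := eventually_coeffNorm_value_sub_lt ψ₀ θ (U := Opens.comap φ₀.hom.base U)
      (φ₀.hom.pullback U f) hW hU (half_pos hε)
    filter_upwards [(hφ x₀).eventually h1, (hψ x₀).eventually h2, (hψ x₀).eventually hC,
      ((tendsto_base ψ₀ x₀).comp (hψ x₀)).eventually (V.isOpen.mem_nhds hV₀)]
      with p hp1 hp2 hpC hpV hW' hU'
    obtain ⟨⟨φ, ψ⟩, x⟩ := p
    have hVφ : V ≤ Opens.comap φ.hom.base U := fun y hy => (hp1 y (hVK hy)).1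
    -- `ψ^* φ^* f = ψ^* (φ^* f - φ₀^* f) + ψ^* φ₀^* f`
    have hbound := hpC hW' hpV
      (𝓜.res hVφ (φ.hom.pullback U f) - 𝓜.res hVφ₀ (φ₀.hom.pullback U f)) _ (fun y hy => by
        rw [map_sub, η.eval_res, η.eval_res]
        exact ((hp1 y (hVK hy)).2 (hVW hy) (hVφ hy) (hVφ₀ hy)).le)
    rw [value_sub, value_res, value_res] at hbound
    have hlast := hp2 hW' (hVφ₀ hpV)
    have hsum := Ext.coeffNorm_add_le
      (value ψ θ (U := Opens.comap φ.hom.base U) (φ.hom.pullback U f) x hW' (hVφ hpV) -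
        value ψ θ (U := Opens.comap φ₀.hom.base U) (φ₀.hom.pullback U f) x hW' (hVφ₀ hpV))
      (value ψ θ (U := Opens.comap φ₀.hom.base U) (φ₀.hom.pullback U f) x hW' (hVφ₀ hpV) -
        value ψ₀ θ (U := Opens.comap φ₀.hom.base U) (φ₀.hom.pullback U f) x₀ hW hU)
    rw [sub_add_sub_cancel] at hsum
    have hCε : C * (ε / (2 * (C + 1))) ≤ ε / 2 := by
      rw [mul_div_assoc', div_le_div_iff₀ (by positivity) two_pos]
      nlinarith
    exact lt_of_le_of_lt hsum (by linarith)

/-! ### Inversion -/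

theorem base_inv_base (φ : 𝓜.Aut) (x : M) : φ⁻¹.hom.base (φ.hom.base x) = x :=
  DFunLike.congr_fun (congrArg SuperalgebraSheaf.Hom.base φ.inv_comp_hom) x

theorem base_base_inv (φ : 𝓜.Aut) (x : M) : φ.hom.base (φ⁻¹.hom.base x) = x :=
  DFunLike.congr_fun (congrArg SuperalgebraSheaf.Hom.base φ.hom_comp_inv) x

/-- The map `(φ, x) ↦ φ⁻¹ x` is continuous at the identity: if `φ` is near the identity, it takes
the complement of a neighbourhood of `x₀`, a compact set, into the complement of a smaller
neighbourhood. -/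
theorem tendsto_base_inv [T2Space M] [CompactSpace M] (x₀ : M) :
    Tendsto (fun p : 𝓜.Aut × M => p.1⁻¹.hom.base p.2) (𝓝 (1, x₀)) (𝓝 x₀) := by
  refine (nhds_basis_opens _).tendsto_right_iff.2 fun s hs => ?_
  obtain ⟨V, K, hV, hVK, hK, hKs⟩ := exists_opens_le_compact (U := ⟨s, hs.2⟩) hs.1
  have hcomp : IsCompact sᶜ := hs.2.isClosed_compl.isCompact
  have h1 : ∀ᶠ φ in 𝓝 (1 : 𝓜.Aut), ∀ x ∈ sᶜ, φ.hom.base x ∈ Kᶜ :=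
    hcomp.eventually_forall_of_forall_eventually fun x hx =>
      (tendsto_base 1 x).eventually (hK.isClosed.isOpen_compl.mem_nhds fun hxK => hx (hKs hxK))
  have h2 : ∀ᶠ x in 𝓝 x₀, x ∈ V := V.isOpen.mem_nhds hV
  rw [nhds_prod_eq]
  filter_upwards [h1.prod_mk h2] with p hp
  by_contra hps
  have := hp.1 _ hps
  rw [base_base_inv] at this
  exact this (hVK hp.2)

variable [IsManifold 𝓘(ℂ, EuclideanSpace ℂ (Fin m)) 1 M]

/-- Bounds for the leading coefficients: if a section `h` over `V` has a small pullback `φ^* h`, and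
small coefficients of degree less than `k`, then also its coefficients of degree `k` are small, for
`φ` near the identity. Removing the terms of degree less than `k` from `h` changes `φ^* h` only by
a small quantity; the coefficients of degree `k` of the remaining terms are transformed by a matrix
that is close to the identity. -/
theorem exists_norm_repr_le_of_card_eq [LocallyCompactSpace M] {x₀ : M} {W V : Opens M}
    (θ : LocalTrivialization m n 𝓜.toSuperalgebraSheaf W) (hV : V ≤ W) (hV₀ : x₀ ∈ V) (k : ℕ) :
    ∃ C : ℝ, 0 ≤ C ∧ ∀ᶠ p in 𝓝 ((1 : 𝓜.Aut), x₀), ∀ (hW : p.2 ∈ W) (hpV : p.1.hom.base p.2 ∈ V)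
      (h : 𝓜.Sections V) (ε : ℝ), Ext.coeffNorm (value p.1 θ h p.2 hW hpV) ≤ ε →
      (∀ y (hy : y ∈ V) (μ : Finset (Fin n)), μ.card < k →
        ‖(Ext.monomial n).repr (θ.eval y (hV hy) hy h) μ‖ ≤ ε) →
      ∀ ν : Finset (Fin n), ν.card = k →
        ‖(Ext.monomial n).repr (θ.eval _ (hV hpV) hpV h) ν‖ ≤ C * ε := by
  obtain ⟨C, hC0, hC⟩ := exists_coeffNorm_value_le (1 : 𝓜.Aut) θ (hV hV₀) θ hV hV₀
  set N : ℝ := Nat.cast (Fintype.card (Finset (Fin n)))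
  have hN0 : 0 < N := by positivity
  refine ⟨2 * (1 + C * N), by positivity, ?_⟩
  let t : Finset (Fin n) → 𝓜.Sections W := fun ν => θ.equiv W le_rfl (1 ⊗ₜ Ext.monomial n ν)
  have htval : ∀ μ, value (1 : 𝓜.Aut) θ (t μ) x₀ (hV hV₀) (hV hV₀) = Ext.monomial n μ := by
    intro μ
    refine (value_one θ (t μ) (hV hV₀) (hV hV₀)).trans ?_
    rw [θ.eval_equiv le_rfl, Model.eval_tmul]
    exact one_smul _ _
  have ht := eventually_all.2 fun μ => eventually_coeffNorm_value_sub_lt (1 : 𝓜.Aut) θ (t μ)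
    (hV hV₀) (hV hV₀) (ε := 1 / (2 * N)) (by positivity)
  filter_upwards [hC, ht] with p hpC hpt hW hpV h ε hε hlow ν hν
  have hε0 : 0 ≤ ε := (Ext.coeffNorm_nonneg _).trans hε
  let a : Model m n V := (θ.equiv V hV).symm h
  have ha : ∀ y (hy : y ∈ V) (μ : Finset (Fin n)),
      (Ext.monomial n).repr (θ.eval y (hV hy) hy h) μ =
        ((Model.basis m n V).repr a μ).1 ⟨y, hy⟩ := fun y hy μ => by
    rw [θ.eval_of_le hV hy, Model.repr_eval]
  -- the terms of degree less than `k`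
  let b : Model m n V := ∑ μ : Finset (Fin n) with μ.card < k,
    (Model.basis m n V).repr a μ • Model.basis m n V μ
  have hb : ∀ μ, (Model.basis m n V).repr b μ =
      if μ.card < k then (Model.basis m n V).repr a μ else 0 := by
    intro μ
    simp only [b, map_sum, map_smul, Module.Basis.repr_self, Finsupp.smul_single, smul_eq_mul,
      mul_one, Finsupp.finsetSum_apply, Finsupp.single_apply, Finset.sum_ite_eq',
      Finset.mem_filter, Finset.mem_univ, true_and]
  let q : Model m n V := ∑ μ : Finset (Fin n) with ¬ μ.card < k,
    (Model.basis m n V).repr a μ • Model.basis m n V μ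
  have hq : ∀ μ, (Model.basis m n V).repr q μ =
      if ¬ μ.card < k then (Model.basis m n V).repr a μ else 0 := by
    intro μ
    simp only [q, map_sum, map_smul, Module.Basis.repr_self, Finsupp.smul_single, smul_eq_mul,
      mul_one, Finsupp.finsetSum_apply, Finsupp.single_apply, Finset.sum_ite_eq',
      Finset.mem_filter, Finset.mem_univ, true_and]
  have hbq : b + q = a :=
    (Finset.sum_filter_add_sum_filter_not _ _ _).trans ((Model.basis m n V).sum_repr a)
  have hbN : ∀ y (hy : y ∈ V), Ext.coeffNorm (θ.eval y (hV hy) hy (θ.equiv V hV b)) ≤ N * ε := by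
    intro y hy
    rw [θ.eval_equiv hV]
    refine (Finset.sum_le_card_nsmul Finset.univ _ ε fun μ _ => ?_).trans_eq
      (by rw [Finset.card_univ, nsmul_eq_mul])
    rw [Model.repr_eval, hb]
    split_ifs with hμ
    · rw [← ha]; exact hlow y hy μ hμ
    · simpa using hε0
  have hφb := hpC hW hpV (θ.equiv V hV b) _ hbN
  let χ := θ.extPoint θ p.1.hom p.2 hW
  have hφ : Ext.coeffNorm (χ.toHom V hpV hV q) ≤ (1 + C * N) * ε := by
    have h1 : χ.toHom V hpV hV q =
        value p.1 θ h p.2 hW hpV - value p.1 θ (θ.equiv V hV b) p.2 hW hpV := by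
      refine eq_sub_of_add_eq' ?_
      have h2 := map_add (χ.toHom V hpV hV) b q
      rw [hbq] at h2
      refine h2.symm.trans ?_
      exact congrArg (fun f => value p.1 θ f p.2 hW hpV) ((θ.equiv V hV).apply_symm_apply h)
    rw [h1]
    refine (Ext.coeffNorm_sub_le _ _).trans ?_
    linarith
  -- the coefficients of degree `k` at the point `φ x`
  let c : Finset (Fin n) → ℂ := fun μ => ((Model.basis m n V).repr a μ).1 ⟨_, hpV⟩
  let A : Finset (Fin n) → Finset (Fin n) → ℂ := fun μ ν =>
    (Ext.monomial n).repr (χ.onExt (hV hpV) (Ext.monomial n μ)) ν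
  have hA : ∀ μ ν, ‖A μ ν - if μ = ν then 1 else 0‖ ≤ 1 / (2 * N) := by
    intro μ ν
    have h1 := (Ext.norm_repr_le _ ν).trans (hpt μ hW (hV hpV)).le
    rw [map_sub, Finsupp.sub_apply, htval, Module.Basis.repr_self, Finsupp.single_apply] at h1
    exact h1
  have hlead : ∀ ν : Finset (Fin n), ν.card = k →
      (Ext.monomial n).repr (χ.toHom V hpV hV q) ν =
      ∑ μ with μ.card = k, c μ * A μ ν := by
    intro ν hν
    rw [χ.repr_toHom_of_card hpV hV q (k := k) (fun μ hμ => by rw [hq, if_neg (not_not.2 hμ)]) hν]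
    refine Finset.sum_congr rfl fun μ hμ => ?_
    rw [hq, if_pos (Finset.mem_filter.1 hμ).2.not_lt]
  set S : ℝ := ∑ μ : Finset (Fin n) with μ.card = k, ‖c μ‖ with hS
  have hS0 : 0 ≤ S := Finset.sum_nonneg fun _ _ => norm_nonneg _
  have hc : ∀ ν : Finset (Fin n), ν.card = k →
      ‖c ν‖ ≤ ‖(Ext.monomial n).repr (χ.toHom V hpV hV q) ν‖ + S * (1 / (2 * N)) := by
    intro ν hν
    have h1 : c ν = (Ext.monomial n).repr (χ.toHom V hpV hV q) ν -
        ∑ μ with μ.card = k, c μ * (A μ ν - if μ = ν then 1 else 0) := by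
      rw [hlead ν hν, ← Finset.sum_sub_distrib]
      simp only [← mul_sub, sub_sub_cancel, mul_ite, mul_one, mul_zero]
      rw [Finset.sum_ite_eq', if_pos (by simp [hν])]
    have h2 : ‖∑ μ : Finset (Fin n) with μ.card = k, c μ * (A μ ν - if μ = ν then 1 else 0)‖ ≤
        S * (1 / (2 * N)) := by
      rw [hS, Finset.sum_mul]
      refine norm_sum_le_of_le _ fun μ _ => ?_
      rw [norm_mul]
      exact mul_le_mul_of_nonneg_left (hA μ ν) (norm_nonneg _)
    rw [h1]
    exact (norm_sub_le _ _).trans (add_le_add_right h2 _)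
  have hS2 : S ≤ 2 * ((1 + C * N) * ε) := by
    have h1 : S ≤ ∑ ν : Finset (Fin n) with ν.card = k,
        (‖(Ext.monomial n).repr (χ.toHom V hpV hV q) ν‖ + S * (1 / (2 * N))) :=
      Finset.sum_le_sum fun ν hν => hc ν (by simpa using hν)
    rw [Finset.sum_add_distrib, Finset.sum_const, nsmul_eq_mul] at h1
    have h2 : ∑ ν : Finset (Fin n) with ν.card = k,
        ‖(Ext.monomial n).repr (χ.toHom V hpV hV q) ν‖ ≤ (1 + C * N) * ε :=
      (Finset.sum_le_univ_sum_of_nonneg fun _ => norm_nonneg _).trans hφ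
    have h3 : ((Finset.univ.filter fun ν : Finset (Fin n) => ν.card = k).card : ℝ) *
        (S * (1 / (2 * N))) ≤ N * (S * (1 / (2 * N))) :=
      mul_le_mul_of_nonneg_right (Nat.cast_le.2 (Finset.card_le_univ _)) (by positivity)
    have h4 : N * (S * (1 / (2 * N))) = S / 2 := by field_simp
    linarith
  rw [ha]
  have h5 : ‖c ν‖ ≤ S := Finset.single_le_sum (f := fun μ => ‖c μ‖) (fun _ _ => norm_nonneg _)
    (by simp [hν])
  calc ‖c ν‖ ≤ 2 * ((1 + C * N) * ε) := h5.trans hS2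
    _ = _ := by ring

/-- Near the identity the coefficients of degree less than `k` of a section `h` are bounded by the
supremum of the values of `φ^* h`. -/
theorem exists_norm_repr_le_of_card_lt [T2Space M] [CompactSpace M] {x₀ : M} {W V : Opens M}
    (θ : LocalTrivialization m n 𝓜.toSuperalgebraSheaf W) (hV : V ≤ W) (hV₀ : x₀ ∈ V) (k : ℕ) :
    ∃ C : ℝ, 0 ≤ C ∧ ∀ᶠ p in 𝓝 ((1 : 𝓜.Aut), x₀), ∀ (hpV : p.2 ∈ V) (h : 𝓜.Sections V) (ε : ℝ),
      0 ≤ ε → (∀ y (hy : y ∈ V) (hyV : p.1.hom.base y ∈ V),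
        Ext.coeffNorm (value p.1 θ h y (hV hy) hyV) ≤ ε) →
      ∀ ν : Finset (Fin n), ν.card < k →
        ‖(Ext.monomial n).repr (θ.eval p.2 (hV hpV) hpV h) ν‖ ≤ C * ε := by
  induction k with
  | zero => exact ⟨0, le_rfl, Eventually.of_forall fun p _ h ε _ _ ν hν => by omega⟩
  | succ k ih =>
    obtain ⟨C, hC0, hC⟩ := ih
    -- a neighbourhood `V₁` of `x₀` where the terms of degree less than `k` are bounded
    rw [nhds_prod_eq] at hC
    obtain ⟨P, hP, Q, hQ, hPQ⟩ := eventually_prod_iff.1 hC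
    obtain ⟨s, hsQ, hs, hxs⟩ := mem_nhds_iff.1 hQ
    let V₁ : Opens M := V ⊓ ⟨s, hs⟩
    have hV₁V : V₁ ≤ V := inf_le_left
    have hxV₁ : x₀ ∈ V₁ := Opens.mem_inf.2 ⟨hV₀, hxs⟩
    obtain ⟨C', hC'0, hC'⟩ := exists_norm_repr_le_of_card_eq θ (hV₁V.trans hV) hxV₁ k
    refine ⟨C + C' * (1 + C), by positivity, ?_⟩
    -- the points `x` are the images of the points `φ⁻¹ x`, which are also near `x₀`
    have hinv : Tendsto (fun p : 𝓜.Aut × M => (p.1, p.1⁻¹.hom.base p.2)) (𝓝 (1, x₀))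
        (𝓝 (1, x₀)) :=
      ((continuous_fst.tendsto' _ _ rfl)).prodMk_nhds (tendsto_base_inv x₀)
    have hP' : ∀ᶠ p in 𝓝 ((1 : 𝓜.Aut), x₀), P p.1 :=
      (continuous_fst.tendsto' ((1 : 𝓜.Aut), x₀) _ rfl).eventually hP
    filter_upwards [hinv.eventually hC', hP', continuous_snd.tendsto' ((1 : 𝓜.Aut), x₀) x₀ rfl
      |>.eventually (V₁.isOpen.mem_nhds hxV₁), (tendsto_base_inv x₀).eventually
      (V₁.isOpen.mem_nhds hxV₁)] with p hpC' hpP hpV₁ hpinv hpV h ε hε0 hε ν hν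
    obtain ⟨φ, x⟩ := p
    have hlow : ∀ y (hy : y ∈ V₁) (μ : Finset (Fin n)), μ.card < k →
        ‖(Ext.monomial n).repr (θ.eval y (hV (hV₁V hy)) (hV₁V hy) h) μ‖ ≤ C * ε :=
      fun y hy => hPQ hpP (hsQ hy.2) (hV₁V hy) h ε hε0 hε
    rcases Nat.lt_succ_iff_lt_or_eq.1 hν with hν | hν
    · refine (hlow x hpV₁ ν hν).trans ?_
      have : 0 ≤ C' * (1 + C) * ε := by positivity
      linarith
    · obtain ⟨x, rfl⟩ : ∃ x', φ.hom.base x' = x := ⟨_, base_base_inv φ x⟩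
      simp only [base_inv_base] at hpC' hpinv
      have hle : ε ≤ (1 + C) * ε := by nlinarith
      have hle' : C * ε ≤ (1 + C) * ε := by nlinarith
      have key := hpC' (hV (hV₁V hpinv)) hpV₁ (𝓜.res hV₁V h) ((1 + C) * ε)
        (by
          rw [value_res]
          exact (hε x (hV₁V hpinv) (hV₁V hpV₁)).trans hle)
        (fun y hy μ hμ => by
          rw [θ.eval_res]
          exact (hlow y hy μ hμ).trans hle') ν hν
      rw [θ.eval_res] at key
      refine key.trans ?_
      have : 0 ≤ C * ε := by positivity
      linarith

/-- Inversion is continuous at the identity: the section `φ⁻¹^* f - f` is small because its pullback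
`f - φ^* f` under `φ` is small. -/
theorem continuousAt_inv_one [T2Space M] [CompactSpace M] :
    ContinuousAt (fun φ : 𝓜.Aut => φ⁻¹) 1 := by
  refine continuousAt_of_value (fun x₀ => tendsto_base_inv x₀) ?_
  intro x₀ U W θ f hW hU ε hε
  change x₀ ∈ U at hU
  obtain ⟨V, K, hV₀, hVK, hK, hKU⟩ :=
    exists_opens_le_compact (U := W ⊓ U) (Opens.mem_inf.2 ⟨hW, hU⟩)
  have hVW : V ≤ W := fun y hy => (hKU (hVK hy)).1
  have hVU : V ≤ U := fun y hy => (hKU (hVK hy)).2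
  obtain ⟨C, hC0, hC⟩ := exists_norm_repr_le_of_card_lt θ hVW hV₀ (n + 1)
  set N : ℝ := Nat.cast (Fintype.card (Finset (Fin n)))
  have hN0 : 0 < N := by positivity
  set δ : ℝ := ε / (2 * (N * C + 1)) with hδ
  have hδ0 : 0 < δ := by positivity
  have hfst : Tendsto (fun p : 𝓜.Aut × M => p.1) (𝓝 (1, x₀)) (𝓝 1) :=
    continuous_fst.tendsto' _ _ rfl
  have hsnd : Tendsto (fun p : 𝓜.Aut × M => p.2) (𝓝 (1, x₀)) (𝓝 x₀) :=
    continuous_snd.tendsto' _ _ rfl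
  have h1 := eventually_forall_coeffNorm_value_sub_lt (1 : 𝓜.Aut) hK θ f (fun y hy => (hKU hy).1)
    (fun y hy => (hKU hy).2) hδ0
  have h2 : ∀ᶠ φ in 𝓝 (1 : 𝓜.Aut), ∀ y ∈ K, φ⁻¹.hom.base y ∈ U :=
    hK.eventually_forall_of_forall_eventually fun y hy =>
      (tendsto_base_inv y).eventually (U.isOpen.mem_nhds (hKU hy).2)
  have h3 := eventually_coeffNorm_value_sub_lt (1 : 𝓜.Aut) θ f hW hU (half_pos hε)
  have hone : Tendsto (fun p : 𝓜.Aut × M => ((1 : 𝓜.Aut), p.2)) (𝓝 (1, x₀)) (𝓝 (1, x₀)) :=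
    (continuous_const.prodMk continuous_snd).tendsto' _ _ rfl
  filter_upwards [hfst.eventually h1, hfst.eventually h2, hone.eventually h3, hC,
    hsnd.eventually (V.isOpen.mem_nhds hV₀)] with p hp1 hp2 hp3 hpC hpV hW' hU'
  obtain ⟨φ, x⟩ := p
  have hVφ : V ≤ Opens.comap φ⁻¹.hom.base U := fun y hy => hp2 y (hVK hy)
  let h : 𝓜.Sections V := 𝓜.res hVφ (φ⁻¹.hom.pullback U f) - 𝓜.res hVU f
  have hh : ∀ y (hy : y ∈ V) (hyV : φ.hom.base y ∈ V),
      Ext.coeffNorm (value φ θ h y (hVW hy) hyV) ≤ δ := by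
    intro y hy hyV
    have e1 : value φ θ h y (hVW hy) hyV = value 1 θ f y (hVW hy) (hVU hy) -
        value φ θ f y (hVW hy) (hVU hyV) := by
      rw [value_sub, value_res, value_res]
      congr 1
      exact (value_mul φ⁻¹ φ θ f (hVW hy) (hVφ hyV)).symm.trans
        (value_congr (inv_mul_cancel φ) θ f _ _ _)
    have e2 := ((hp1 y (hVK hy)).2 (hVW hy) (hVU hyV) (hVU hy)).le
    rwa [e1, Ext.coeffNorm_sub_comm]
  have hrepr := hpC hpV h δ hδ0.le hh
  have hnorm : Ext.coeffNorm (θ.eval x (hVW hpV) hpV h) ≤ N * (C * δ) := by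
    refine (Finset.sum_le_card_nsmul Finset.univ _ (C * δ) fun ν _ => hrepr ν ?_).trans_eq
      (by rw [Finset.card_univ, nsmul_eq_mul])
    exact Nat.lt_succ_of_le (by simpa using Finset.card_le_univ ν)
  have e3 : θ.eval x (hVW hpV) hpV h = value φ⁻¹ θ f x hW' hU' -
      value 1 θ f x hW' (hVU hpV) := by
    rw [map_sub, θ.eval_res, θ.eval_res]
    rfl
  rw [e3] at hnorm
  have hlast := hp3 hW' (hVU hpV)
  have hsum := Ext.coeffNorm_add_le (value φ⁻¹ θ f x hW' hU' - value 1 θ f x hW' (hVU hpV))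
    (value 1 θ f x hW' (hVU hpV) - value 1 θ f x₀ hW hU)
  rw [sub_add_sub_cancel] at hsum
  have hle : N * (C * δ) ≤ ε / 2 := by
    rw [hδ, ← mul_assoc, mul_div_assoc', div_le_div_iff₀ (by positivity) two_pos]
    nlinarith
  exact lt_of_le_of_lt hsum (by linarith)

end ComplexSupermanifold
end Super

end

theorem mainTheorem8 {m n : ℕ} {M : Type u} [TopologicalSpace M] [T2Space M] [CompactSpace M]
    [ChartedSpace (EuclideanSpace ℂ (Fin m)) M]
    [IsManifold 𝓘(ℂ, EuclideanSpace ℂ (Fin m)) ω M]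
    (𝓜 : Super.ComplexSupermanifold m n M) :
    IsTopologicalGroup 𝓜.Aut := by
  have : IsManifold 𝓘(ℂ, EuclideanSpace ℂ (Fin m)) 1 M := IsManifold.of_le le_top
  have hmul : ContinuousMul 𝓜.Aut := ⟨Super.ComplexSupermanifold.continuous_mul⟩
  refine { hmul with continuous_inv := continuous_iff_continuousAt.2 fun φ₀ => ?_ }
  -- translation reduces continuity of the inversion to continuity at the identity
  have h1 : Filter.Tendsto (fun φ => φ₀⁻¹ * φ) (nhds φ₀) (nhds 1) :=
    (continuous_const_mul φ₀⁻¹).tendsto' _ _ (inv_mul_cancel φ₀)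
  have h2 := (Super.ComplexSupermanifold.continuousAt_inv_one (𝓜 := 𝓜)).tendsto.comp h1
  have h3 := h2.mul_const φ₀⁻¹
  simpa [ContinuousAt, Function.comp_def] using h3
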